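/- **Theorem (measure-valued–strong uniqueness for balance laws).** Let $n,d\in\mathbb N$, $T\in(0,\infty)$, $p\in(1,\infty)$, $\mathbb T^d=(\mathbb R/2\pi\mathbb Z)^d$, $Q_T=\mathbb T^d\times[0,T)$, $\overline{Q_T}=\mathbb T^d\times[0,T]$. Sums over repeated indices $\alpha=1,\dots,d$ are understood. Let $A,F_\alpha,G:\mathbb R^n\to\mathbb R^n$ and $\eta:\mathbb R^n\to\mathbb R$ be $C^2$, $q_\alpha:\mathbb R^n\to\mathbb R$ differentiable and $P:\mathbb R^n\to\mathbb R^n$ be $C^1$, such that * (H$_1$) $A$ is one-to-one and $\nabla A(u)$ is nonsingular for all $u\in\mathbb R^n$; * (H$_2$) $\nabla\eta=G\cdot\nabla A$ and $\nabla q_\alpha=G\cdot\nabla F_\alpha$ for all $\alpha$; * (H$_3$) $\xi\cdot\big(\nabla^2\eta(u)-G(u)\cdot\nabla^2A(u)\big)\xi>0$ for all $u\in\mathbb R^n$ and $\xi\in\mathbb R^n\setminus\{0\}$; * (A$_1$) $\beta_1(|u|^p+1)-B\le\eta(u)\le\beta_2(|u|^p+1)$ for all $u$, with some constants $\beta_1,\beta_2,B>0$;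 * (A$_2$), (A$_3$) $|F_\alpha(u)|/\eta(u)\to0$ for all $\alpha$, and $|A(u)|/\eta(u)\to0$, as $|u|\to\infty$; * (A$_4$) $\frac1C(|A(u)|^r+1)-B'\le\eta(u)\le C(|A(u)|^r+1)$ for all $u$, with some exponent $r>1$ and constants $C,B'>0$; * $\eta(u)\ge0$ for all $u$. Assume moreover that either * (i) $(G(u)-G(w))\cdot(P(u)-P(w))\le0$ for all $u,w\in\mathbb R^n$, and (A$_G$): $|G(u)|/\eta(u)\to0$ as $|u|\to\infty$; or * (ii) (A$_G$) holds and (A$_P$): $|G(u)\cdot P(u)|/\eta(u)\to0$ and $|P(u)|/\eta(u)\to0$ as $|u|\to\infty$. A *dissipative measure-valued solution* $(u,\nu,\gamma)$ with initial data $(\nu_0,\gamma_0)$ of $$\partial_tA(u)+\partial_\alpha F_\alpha(u)=P(u),\qquad \partial_t\eta(u)+\partial_\alpha q_\alpha(u)\le G(u)\cdot P(u)$$ consists of $u\in L^\infty(0,T;L^p(\mathbb T^d;\mathbb R^n))$, measurable families $\nu=(\nu_{x,t})$ and $\nu_0=(\nu_{0,x})$ of probability measures on $\mathbb R^n$, and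 non-negative Radon measures $\gamma$ on $Q_T$ and $\gamma_0$ on $\mathbb T^d$, such that $u(x,t)=\langle\nu_{x,t},\lambda\rangle$ for almost every $(x,t)\in Q_T$; the pairings $\langle\nu,A\rangle,\langle\nu,F_\alpha\rangle,\langle\nu,P\rangle,\langle\nu,\eta\rangle,\langle\nu,G\cdot P\rangle$ are defined almost everywhere and integrable on $Q_{T'}$ for every $T'<T$, and $\langle\nu_0,A\rangle,\langle\nu_0,\eta\rangle$ are defined almost everywhere and integrable on $\mathbb T^d$; $$\iint_{Q_T}\langle\nu_{x,t},A\rangle\,\partial_t\varphi+\langle\nu_{x,t},F_\alpha\rangle\,\partial_\alpha\varphi+\langle\nu_{x,t},P\rangle\,\varphi\;dx\,dt+\int_{\mathbb T^d}\langle\nu_{0,x},A\rangle\,\varphi(x,0)\,dx=0$$ for all $\varphi\in C^1_c(\mathbb T^d\times[0,T))$; and $$\iint_{Q_T}\frac{d\xi}{dt}\big[\langle\nu_{x,t},\eta\rangle\,dx\,dt+\gamma(dx\,dt)\big]+\int_{\mathbb T^d}\xi(0)\big[\langle\nu_{0,x},\eta\rangle\,dx+\gamma_0(dx)\big]+\iint_{Q_T}\xi\,\langle\nu_{x,t},G\cdot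 P\rangle\,dx\,dt\ge0$$ for all $\xi=\xi(t)\in C^1_c([0,T))$ with $\xi\ge0$. Let $(u,\nu,\gamma)$ be such a solution, and let $\bar u\in W^{1,\infty}(\overline{Q_T};\mathbb R^n)$ (that is, $\bar u$ is Lipschitz on $\overline{Q_T}$) be a strong solution: $\partial_tA(\bar u)+\partial_\alpha F_\alpha(\bar u)=P(\bar u)$ almost everywhere on $Q_T$ (and hence also $\partial_t\eta(\bar u)+\partial_\alpha q_\alpha(\bar u)=G(\bar u)\cdot P(\bar u)$). If $\gamma_0=0$ and $\nu_{0,x}=\delta_{\bar u(x,0)}$ for almost every $x\in\mathbb T^d$, then $\nu_{x,t}=\delta_{\bar u(x,t)}$ and $u(x,t)=\bar u(x,t)$ for almost every $(x,t)\in Q_T$. -/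

import Mathlib

open MeasureTheory ProbabilityTheory Filter Set Asymptotics
open scoped ENNReal NNReal Topology

namespace BalanceLaw

noncomputable section

/-- The state space `ℝⁿ` with its Euclidean norm. -/
abbrev State (n : ℕ) : Type := EuclideanSpace ℝ (Fin n)

instance fact_two_pi_pos : Fact (0 < 2 * Real.pi) := ⟨Real.two_pi_pos⟩

/-- The flat torus `𝕋ᵈ = (ℝ/2πℤ)ᵈ`; its `volume` is Lebesgue measure, of total mass `(2π)ᵈ`. -/
abbrev Torus (d : ℕ) : Type := Fin d → AddCircle (2 * Real.pi)

/-- The covering map `ℝᵈ → 𝕋ᵈ`. -/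
def Torus.mk {d : ℕ} (y : Fin d → ℝ) : Torus d := fun i => (y i : AddCircle (2 * Real.pi))

/-- The partial derivative `∂_α f (x)` of a function on the torus. -/
def pderiv {d : ℕ} {V : Type*} [NormedAddCommGroup V] [NormedSpace ℝ V]
    (α : Fin d) (f : Torus d → V) (x : Torus d) : V :=
  deriv (fun h : ℝ => f (x + Pi.single α (h : AddCircle (2 * Real.pi)))) 0

/-- `Q_T = 𝕋ᵈ × [0, T)`. -/
def cyl (d : ℕ) (T : ℝ) : Set (Torus d × ℝ) := univ ×ˢ Ico 0 T

/-! ### The constitutive functions -/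

/-- The structural hypotheses on the fluxes `A`, `F_α` and the entropy pair `η`, `q_α` with
multiplier `G`. -/
structure EntropyStructure {n d : ℕ} (A : State n → State n) (F : Fin d → State n → State n)
    (η : State n → ℝ) (q : Fin d → State n → ℝ) (G : State n → State n) : Prop where
  contDiff_A : ContDiff ℝ 2 A
  contDiff_F : ∀ α, ContDiff ℝ 2 (F α)
  contDiff_G : ContDiff ℝ 2 G
  contDiff_η : ContDiff ℝ 2 η
  differentiable_q : ∀ α, Differentiable ℝ (q α)
  /-- `A` is one-to-one. -/
  injective_A : Function.Injective A
  /-- `∇A(u)` is nonsingular. -/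
  nonsingular : ∀ u, (fderiv ℝ A u).det ≠ 0
  /-- `∇η = G · ∇A`. -/
  grad_η : ∀ u ξ, fderiv ℝ η u ξ = inner ℝ (G u) (fderiv ℝ A u ξ)
  /-- `∇q_α = G · ∇F_α`. -/
  grad_q : ∀ α u ξ, fderiv ℝ (q α) u ξ = inner ℝ (G u) (fderiv ℝ (F α) u ξ)
  /-- `∇²η(u) - G(u) · ∇²A(u)` is positive definite. -/
  pos_def : ∀ u ξ, ξ ≠ 0 →
    0 < fderiv ℝ (fderiv ℝ η) u ξ ξ - inner ℝ (G u) (fderiv ℝ (fderiv ℝ A) u ξ ξ)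

/-- The growth hypotheses on `η`, `F_α` and `A`, with exponent `p` for `η` as a function of `u`. -/
structure GrowthConditions {n d : ℕ} (p : ℝ) (A : State n → State n)
    (F : Fin d → State n → State n) (η : State n → ℝ) : Prop where
  /-- `β₁ (|u|^p + 1) - B ≤ η(u) ≤ β₂ (|u|^p + 1)`. -/
  growth_η : ∃ β₁ β₂ B : ℝ, 0 < β₁ ∧ 0 < β₂ ∧ 0 < B ∧
    ∀ u, β₁ * (‖u‖ ^ p + 1) - B ≤ η u ∧ η u ≤ β₂ * (‖u‖ ^ p + 1)
  /-- `|F_α(u)| / η(u) → 0` as `|u| → ∞`. -/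
  growth_F : ∀ α, F α =o[Bornology.cobounded (State n)] η
  /-- `|A(u)| / η(u) → 0` as `|u| → ∞`. -/
  growth_A : A =o[Bornology.cobounded (State n)] η
  /-- `C⁻¹ (|A(u)|^r + 1) - B ≤ η(u) ≤ C (|A(u)|^r + 1)` for some exponent `r > 1`. -/
  growth_H : ∃ r C B : ℝ, 1 < r ∧ 0 < C ∧ 0 < B ∧
    ∀ u, 1 / C * (‖A u‖ ^ r + 1) - B ≤ η u ∧ η u ≤ C * (‖A u‖ ^ r + 1)

/-- The production `P` is weakly dissipative with respect to the multiplier `G`. -/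
def WeaklyDissipative {n : ℕ} (G P : State n → State n) : Prop :=
  ∀ u w, inner ℝ (G u - G w) (P u - P w) ≤ 0

/-- `|G(u)| / η(u) → 0` as `|u| → ∞`. -/
def GrowthG {n : ℕ} (G : State n → State n) (η : State n → ℝ) : Prop :=
  G =o[Bornology.cobounded (State n)] η

/-- `|G(u) · P(u)| / η(u) → 0` and `|P(u)| / η(u) → 0` as `|u| → ∞`. -/
def GrowthP {n : ℕ} (G P : State n → State n) (η : State n → ℝ) : Prop :=
  (fun u => (inner ℝ (G u) (P u) : ℝ)) =o[Bornology.cobounded (State n)] η ∧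
    P =o[Bornology.cobounded (State n)] η

/-! ### Strong solutions -/

/-- `ū ∈ W^{1,∞}(𝕋ᵈ × [0, T])`, i.e. `ū` is Lipschitz up to the boundary, and
`∂_t A(ū) + ∂_α F_α(ū) = P(ū)` almost everywhere on `Q_T`. The entropy identity
`∂_t η(ū) + ∂_α q_α(ū) = G(ū) · P(ū)` is then a consequence of the chain rule. -/
structure IsStrongSolution {n d : ℕ} (T : ℝ) (A : State n → State n)
    (F : Fin d → State n → State n) (P : State n → State n)
    (ubar : Torus d → ℝ → State n) : Prop where
  lipschitz : ∃ K : ℝ≥0,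
    LipschitzOnWith K (fun z : Torus d × ℝ => ubar z.1 z.2) (univ ×ˢ Icc 0 T)
  equation : ∀ᵐ z ∂(volume.restrict (cyl d T)),
    deriv (fun s => A (ubar z.1 s)) z.2 + ∑ α, pderiv α (fun y => F α (ubar y z.2)) z.1
      = P (ubar z.1 z.2)

/-! ### Measure-valued solutions -/

/-- Test functions `φ ∈ C¹_c(𝕋ᵈ × [0, T))` (not necessarily zero at `t = 0`), as restrictions of
`C¹` functions on `𝕋ᵈ × ℝ`. -/
structure IsTest {d : ℕ} (T : ℝ) (φ : Torus d → ℝ → ℝ) : Prop where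
  contDiff : ContDiff ℝ 1 (fun y : (Fin d → ℝ) × ℝ => φ (Torus.mk y.1) y.2)
  support : ∃ T' < T, ∀ x, ∀ t ≥ T', φ x t = 0

/-- Nonnegative test functions `ξ ∈ C¹_c([0, T))` of time, as restrictions of `C¹` functions
on `ℝ`. -/
structure IsTimeTest (T : ℝ) (ξ : ℝ → ℝ) : Prop where
  contDiff : ContDiff ℝ 1 ξ
  support : ∃ T' < T, ∀ t ≥ T', ξ t = 0
  nonneg : ∀ t ≥ 0, 0 ≤ ξ t

/-- The function `z ↦ ⟨ν_z, f⟩ = ∫ f(w) dν_z(w)`. -/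
def avg {X : Type*} [MeasurableSpace X] {n : ℕ} {V : Type*} [NormedAddCommGroup V]
    [NormedSpace ℝ V] (ν : Kernel X (State n)) (f : State n → V) (z : X) : V :=
  ∫ w, f w ∂(ν z)

/-- The pairing `⟨ν, f⟩` is defined `μ`-almost everywhere and is a `μ`-integrable function. -/
def AvgIntegrable {X : Type*} [MeasurableSpace X] {n : ℕ} {V : Type*} [NormedAddCommGroup V]
    [NormedSpace ℝ V] (μ : Measure X) (ν : Kernel X (State n)) (f : State n → V) : Prop :=
  (∀ᵐ z ∂μ, Integrable f (ν z)) ∧ Integrable (avg ν f) μ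

/-- `(u, ν, γ)` is a dissipative measure-valued solution with concentration, with initial data
`(ν₀, γ₀)`, of the balance law `∂_t A(u) + ∂_α F_α(u) = P(u)` with the entropy condition
`∂_t η(u) + ∂_α q_α(u) ≤ G(u) · P(u)`.
The Young measures `ν` and `ν₀` are measurable families of probability measures on `ℝⁿ`; only the
values of `ν` and `γ` on `Q_T` matter. -/
structure IsDissipativeMVSolution {n d : ℕ} (T p : ℝ) (A : State n → State n)
    (F : Fin d → State n → State n) (P : State n → State n) (η : State n → ℝ)
    (G : State n → State n)
    (u : Torus d → ℝ → State n) (ν : Kernel (Torus d × ℝ) (State n))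
    (γ : Measure (Torus d × ℝ)) (ν₀ : Kernel (Torus d) (State n))
    (γ₀ : Measure (Torus d)) : Prop where
  markov : IsMarkovKernel ν
  markov₀ : IsMarkovKernel ν₀
  /-- `γ` is a (nonnegative) Radon measure on `Q_T`. -/
  radon : ∀ T' < T, γ (univ ×ˢ Icc 0 T') < ∞
  /-- `γ₀` is a (nonnegative) Radon measure on `𝕋ᵈ`. -/
  radon₀ : IsFiniteMeasure γ₀
  /-- `u ∈ L^∞(0, T; L^p(𝕋ᵈ))`. -/
  bound_u : ∃ M : ℝ≥0, ∀ᵐ t ∂(volume.restrict (Ioo 0 T)),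
    MemLp (fun x => u x t) (ENNReal.ofReal p) volume ∧
      eLpNorm (fun x => u x t) (ENNReal.ofReal p) volume ≤ M
  /-- `u(x, t) = ⟨ν_{x,t}, λ⟩`. -/
  mean : ∀ᵐ z ∂(volume.restrict (cyl d T)),
    Integrable (fun w => w) (ν z) ∧ u z.1 z.2 = avg ν (fun w => w) z
  /-- The pairings in the averaged equations are well defined. -/
  integrable_A : ∀ T' < T, AvgIntegrable (volume.restrict (cyl d T')) ν A
  integrable_F : ∀ T' < T, ∀ α, AvgIntegrable (volume.restrict (cyl d T')) ν (F α)
  integrable_P : ∀ T' < T, AvgIntegrable (volume.restrict (cyl d T')) ν P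
  integrable_η : ∀ T' < T, AvgIntegrable (volume.restrict (cyl d T')) ν η
  integrable_GP : ∀ T' < T,
    AvgIntegrable (volume.restrict (cyl d T')) ν (fun w => (inner ℝ (G w) (P w) : ℝ))
  integrable_A₀ : AvgIntegrable volume ν₀ A
  integrable_η₀ : AvgIntegrable volume ν₀ η
  /-- The averaged balance law, as an identity in `ℝⁿ`. -/
  equation : ∀ φ : Torus d → ℝ → ℝ, IsTest T φ →
    (∫ z in cyl d T, deriv (φ z.1) z.2 • avg ν A z)
      + (∫ z in cyl d T, ∑ α, pderiv α (fun y => φ y z.2) z.1 • avg ν (F α) z)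
      + (∫ z in cyl d T, φ z.1 z.2 • avg ν P z)
      + (∫ x, φ x 0 • avg ν₀ A x) = 0
  /-- The averaged entropy inequality, integrated in space, with concentrations. -/
  entropy : ∀ ξ : ℝ → ℝ, IsTimeTest T ξ →
    0 ≤ (∫ z in cyl d T, deriv ξ z.2 * avg ν η z)
      + (∫ z in cyl d T, deriv ξ z.2 ∂γ)
      + ξ 0 * ((∫ x, avg ν₀ η x) + γ₀.real univ)
      + (∫ z in cyl d T, ξ z.2 * avg ν (fun w => (inner ℝ (G w) (P w) : ℝ)) z)

end

end BalanceLaw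

/-!
The map `A` is a proper local diffeomorphism, hence a global one, and in the conserved variables
`v = A(u)` the entropy `H = η ∘ A⁻¹` is convex with gradient `g = G ∘ A⁻¹`. The relative entropy
`H(w | v) = H(w) - H(v) - g(v) · (w - v)` is, uniformly for `v` in a compact set, bounded below by
a multiple of `|w - v|²` for `w` near `v` and by a multiple of `1 + H(w)` for `w` far from `v`. The
quadratic remainders of the fluxes and of the production are therefore at most `C H(w | v)`.

Let `V = A(ū)` and let `μ` be the image of `ν` under `A`. Testing the averaged balance law with
`ξ(t) g(V)`, which is only Lipschitz and is admissible by mollification, and subtracting the result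
from the entropy inequality yields `∬ (ξ' + C ξ) ⟨μ, H(· | V)⟩ dx dt + ∬ ξ' dγ ≥ 0`, because the
terms in which `V` is differentiated combine to the flux remainder and a total divergence. For
`ξ(t) = exp(-C t) ((T' - t)⁺)²` the weight `ξ' + C ξ` is negative before `T'`, so `H(· | V)`
vanishes `μ`-almost surely and `μ` is the Dirac mass at `V`.
-/

namespace BalanceLaw

section Mollification

open scoped Convolution

variable {E : Type*} [NormedAddCommGroup E]

/-- Smooth bumps at the origin of radius tending to `0`. The outer radius is twice the inner one,
as Lebesgue differentiation along their supports requires a bounded ratio. -/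
noncomputable def shrinkingBump (k : ℕ) : ContDiffBump (0 : E) where
  rIn := 1 / ((k : ℝ) + 1)
  rOut := 2 * (1 / ((k : ℝ) + 1))
  rIn_pos := by positivity
  rIn_lt_rOut := lt_two_mul_self (by positivity)

lemma tendsto_shrinkingBump_rOut :
    Tendsto (fun k => (shrinkingBump k : ContDiffBump (0 : E)).rOut) atTop (𝓝 0) := by
  simpa only [shrinkingBump, mul_zero] using
    (tendsto_one_div_add_atTop_nhds_zero_nat (𝕜 := ℝ)).const_mul 2

variable [NormedSpace ℝ E] [FiniteDimensional ℝ E] [MeasurableSpace E] {μ : Measure E}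

variable {G : Type*} [SeminormedAddCommGroup G] {π : E →+ G} {f : G → ℝ}

/-- The regularization at scale `1 / (k + 1)` of a function `f` on a group `G`, by convolution
with bump functions carried over from the vector space `E` along a homomorphism `π : E → G`. For
the covering map of a torus, no periodicity has to be tracked. -/
noncomputable def mollify (μ : Measure E) (π : E →+ G) (f : G → ℝ) (k : ℕ) (x : G) : ℝ :=
  ∫ y, (shrinkingBump k : ContDiffBump (0 : E)).normed μ y * f (x - π y) ∂μ

lemma mollify_comp (k : ℕ) :
    (fun y => mollify μ π f k (π y)) = (shrinkingBump k : ContDiffBump (0 : E)).normed μ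
      ⋆[ContinuousLinearMap.lsmul ℝ ℝ, μ] fun y => f (π y) := by
  ext x
  simp only [mollify, convolution_lsmul, map_sub, smul_eq_mul]

lemma mollify_eq_zero {k : ℕ} {x : G}
    (hf : ∀ y : E, ‖y‖ < (shrinkingBump k : ContDiffBump (0 : E)).rOut → f (x - π y) = 0) :
    mollify μ π f k x = 0 := by
  refine integral_eq_zero_of_ae (.of_forall fun y => ?_)
  rcases lt_or_ge ‖y‖ (shrinkingBump k : ContDiffBump (0 : E)).rOut with hy | hy
  · simp only [hf y hy, mul_zero, Pi.zero_apply]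
  · simp only [ContDiffBump.normed, ContDiffBump.zero_of_le_dist _ ((dist_zero_right y).symm ▸ hy),
      zero_div, zero_mul, Pi.zero_apply]

variable [BorelSpace E] [μ.IsAddHaarMeasure] {K : ℝ≥0}

lemma lineDeriv_convolution_of_lipschitzWith {φ g : E → ℝ} (hφ : ContDiff ℝ 1 φ)
    (hφc : HasCompactSupport φ) (hg : LipschitzWith K g) (x v : E) :
    lineDeriv ℝ (φ ⋆[ContinuousLinearMap.lsmul ℝ ℝ, μ] g) x v
      = (φ ⋆[ContinuousLinearMap.lsmul ℝ ℝ, μ] fun y => lineDeriv ℝ g y v) x := by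
  set c := φ ⋆[ContinuousLinearMap.lsmul ℝ ℝ, μ] g
  have hc : ContDiff ℝ 1 c :=
    hφc.contDiff_convolution_left (n := 1) _ hφ hg.continuous.locallyIntegrable
  have hint (t : ℝ) : Integrable (fun y => φ y * g (x + t • v - y)) μ :=
    (hφ.continuous.mul (hg.continuous.comp (by fun_prop))).integrable_of_hasCompactSupport
      hφc.mul_right
  have hreflect (y : E) : lineDeriv ℝ (fun y => g (x - y)) y (-v) = lineDeriv ℝ g (x - y) v := by
    simp only [lineDeriv, smul_neg, ← sub_eq_add_neg, sub_sub_eq_add_sub, add_sub_right_comm]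
  have hlim : Tendsto (fun t : ℝ => t⁻¹ • (c (x + t • v) - c x)) (𝓝[>] 0)
      (𝓝 (∫ y, lineDeriv ℝ g (x - y) v * φ y ∂μ)) := by
    have hg' : LipschitzWith K fun y => g (x - y) := by
      simpa only [mul_one, Function.comp_def] using
        hg.comp (LipschitzWith.of_edist_le fun y z => (edist_sub_left x y z).le)
    simp only [← hreflect]
    refine (LipschitzWith.integral_inv_smul_sub_mul_tendsto_integral_lineDeriv_mul hg'
      (hφ.continuous.integrable_of_hasCompactSupport hφc) (-v)).congr fun t => ?_
    have h0 := hint 0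
    simp only [zero_smul, add_zero] at h0
    simp only [c, convolution_lsmul, smul_eq_mul, ← integral_sub (hint t) h0,
      ← integral_const_mul]
    refine integral_congr_ae (.of_forall fun y => ?_)
    simp only [smul_neg, ← sub_eq_add_neg, sub_sub_eq_add_sub, add_sub_right_comm]
    ring
  have hderiv : Tendsto (fun t : ℝ => t⁻¹ • (c (x + t • v) - c x)) (𝓝[>] 0)
      (𝓝 (lineDeriv ℝ c x v)) :=
    ((hc.differentiable one_ne_zero x).lineDifferentiableAt.hasLineDerivAt
      ).tendsto_slope_zero_right
  simp only [tendsto_nhds_unique hderiv hlim, convolution_lsmul, smul_eq_mul, mul_comm]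

lemma contDiff_mollify_comp (hf : Continuous fun y => f (π y)) (k : ℕ) :
    ContDiff ℝ 1 fun y => mollify μ π f k (π y) := by
  rw [mollify_comp]
  exact (ContDiffBump.hasCompactSupport_normed _).contDiff_convolution_left (n := 1) _
    (ContDiffBump.contDiff_normed _) hf.locallyIntegrable

lemma ae_tendsto_lineDeriv_mollify (hf : LipschitzWith K fun y => f (π y)) (v : E) :
    ∀ᵐ x ∂μ, Tendsto (fun k => lineDeriv ℝ (fun y => mollify μ π f k (π y)) x v) atTop
      (𝓝 (lineDeriv ℝ (fun y => f (π y)) x v)) := by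
  simp_rw [mollify_comp, lineDeriv_convolution_of_lipschitzWith
    (ContDiffBump.contDiff_normed _) (ContDiffBump.hasCompactSupport_normed _) hf]
  exact ContDiffBump.ae_convolution_tendsto_right_of_locallyIntegrable (K := 2)
    tendsto_shrinkingBump_rOut (.of_forall fun k => le_rfl) (hf.locallyIntegrable_lineDeriv v)

lemma tendsto_mollify (hπ : Continuous π) (hf : Continuous f) (x : G) :
    Tendsto (fun k => mollify μ π f k x) atTop (𝓝 (f x)) := by
  have hmollify (k : ℕ) : mollify μ π f k x = ((shrinkingBump k : ContDiffBump (0 : E)).normed μ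
      ⋆[ContinuousLinearMap.lsmul ℝ ℝ, μ] fun y => f (x + π y)) 0 := by
    simp only [mollify, convolution_lsmul, zero_sub, map_neg, ← sub_eq_add_neg, smul_eq_mul]
  have hcont : Continuous fun y => f (x + π y) := by fun_prop
  simp only [hmollify]
  convert ContDiffBump.convolution_tendsto_right (μ := μ) (g := fun _ y => f (x + π y))
    (k := fun _ => 0) tendsto_shrinkingBump_rOut (.of_forall fun _ => hcont.aestronglyMeasurable)
    ((hcont.tendsto 0).comp tendsto_snd) tendsto_const_nhds using 2
  rw [map_zero, add_zero]

lemma lipschitzWith_mollify (hπ : Continuous π) (hf : LipschitzWith K f) (k : ℕ) :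
    LipschitzWith K (mollify μ π f k) := by
  set φ := (shrinkingBump k : ContDiffBump (0 : E))
  have hfc := hf.continuous
  have hint (x : G) : Integrable (fun y => φ.normed μ y * f (x - π y)) μ :=
    (φ.continuous_normed.mul (by fun_prop)).integrable_of_hasCompactSupport
      φ.hasCompactSupport_normed.mul_right
  refine LipschitzWith.of_dist_le_mul fun x y => ?_
  calc dist (mollify μ π f k x) (mollify μ π f k y)
      = ‖∫ z, φ.normed μ z * (f (x - π z) - f (y - π z)) ∂μ‖ := by
        simp only [mollify, dist_eq_norm, mul_sub, ← integral_sub (hint x) (hint y), φ]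
    _ ≤ ∫ z, φ.normed μ z * (K * dist x y) ∂μ := by
        refine norm_integral_le_of_norm_le (φ.integrable_normed.mul_const _)
          (.of_forall fun z => ?_)
        rw [norm_mul, Real.norm_of_nonneg (φ.nonneg_normed z), ← dist_eq_norm]
        gcongr
        · exact φ.nonneg_normed z
        · simpa only [dist_sub_right] using hf.dist_le_mul (x - π z) (y - π z)
    _ = K * dist x y := by rw [integral_mul_const, φ.integral_normed, one_mul]

end Mollification

section TorusCalculus

variable {d : ℕ} {V : Type*} [NormedAddCommGroup V]

instance isAddHaarMeasure_volume_cover :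
    (volume : Measure ((Fin d → ℝ) × ℝ)).IsAddHaarMeasure :=
  inferInstanceAs ((volume : Measure (Fin d → ℝ)).prod (volume : Measure ℝ)).IsAddHaarMeasure

/-- The covering homomorphism `ℝᵈ × ℝ → 𝕋ᵈ × ℝ` of the space-time cylinder. -/
noncomputable def Torus.cover (d : ℕ) : (Fin d → ℝ) × ℝ →+ Torus d × ℝ where
  toFun y := (Torus.mk y.1, y.2)
  map_zero' := rfl
  map_add' _ _ := rfl

lemma Torus.cover_apply (y : (Fin d → ℝ) × ℝ) : Torus.cover d y = (Torus.mk y.1, y.2) := rfl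

/-- The representative in `(0, 2π]ᵈ` of a point of the torus. -/
noncomputable def Torus.rep (x : Torus d) : Fin d → ℝ :=
  fun i => (AddCircle.equivIoc (2 * Real.pi) 0 (x i) : ℝ)

lemma Torus.mk_rep (x : Torus d) : Torus.mk (Torus.rep x) = x :=
  funext fun i => (AddCircle.equivIoc (2 * Real.pi) 0).symm_apply_apply (x i)

lemma Torus.quasiMeasurePreserving_rep :
    Measure.QuasiMeasurePreserving (fun z : Torus d × ℝ => (Torus.rep z.1, z.2)) := by
  have hcircle : MeasurePreserving
      (fun x : AddCircle (2 * Real.pi) => (AddCircle.equivIoc (2 * Real.pi) 0 x : ℝ)) volume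
      (volume.restrict (Ioc 0 (0 + 2 * Real.pi))) :=
    (measurePreserving_subtype_coe measurableSet_Ioc).comp
      (AddCircle.measurePreserving_equivIoc (2 * Real.pi) (a := 0))
  have hprod := (measurePreserving_pi
    (fun _ : Fin d => (volume : Measure (AddCircle (2 * Real.pi)))) _ fun _ => hcircle).prod
    (MeasurePreserving.id (volume : Measure ℝ))
  refine ⟨hprod.measurable, hprod.map_eq.absolutelyContinuous.trans (.prod ?_ .rfl)⟩
  rw [← Measure.restrict_pi_pi]
  exact Measure.restrict_le_self.absolutelyContinuous

lemma ae_of_ae_cover {p : Torus d × ℝ → Prop}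
    (h : ∀ᵐ y : (Fin d → ℝ) × ℝ, p (Torus.cover d y)) : ∀ᵐ z, p z := by
  filter_upwards [Torus.quasiMeasurePreserving_rep.ae h] with z hz
  simpa only [Torus.cover_apply, Torus.mk_rep] using hz

lemma dist_coe_addCircle_le (s t : ℝ) :
    dist (s : AddCircle (2 * Real.pi)) (t : AddCircle (2 * Real.pi)) ≤ dist s t := by
  rw [dist_eq_norm, dist_eq_norm, ← AddCircle.coe_sub]
  exact QuotientAddGroup.norm_mk_le_norm

lemma Torus.lipschitzWith_cover : LipschitzWith 1 (Torus.cover d) := by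
  refine LipschitzWith.of_dist_le_mul fun x y => ?_
  rw [NNReal.coe_one, one_mul, Prod.dist_eq, Prod.dist_eq]
  exact max_le_max ((dist_pi_le_iff dist_nonneg).2 fun i =>
    (dist_coe_addCircle_le _ _).trans (dist_le_pi_dist x.1 y.1 i)) le_rfl

lemma Torus.lipschitzWith_add_single (α : Fin d) (x : Torus d) :
    LipschitzWith 1 fun h : ℝ => x + Pi.single α (h : AddCircle (2 * Real.pi)) := by
  refine LipschitzWith.of_dist_le_mul fun s t => ?_
  rw [dist_add_left, NNReal.coe_one, one_mul]
  exact ((Isometry.single α).dist_eq _ _).trans_le (dist_coe_addCircle_le s t)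

lemma Torus.mk_add_smul_single (y : Fin d → ℝ) (α : Fin d) (h : ℝ) :
    Torus.mk (y + h • Pi.single α 1) = Torus.mk y + Pi.single α (h : AddCircle (2 * Real.pi)) := by
  ext i
  rcases eq_or_ne i α with rfl | hi
  · simp [Torus.mk]
  · simp [Torus.mk, hi]

section Lipschitz

variable {f : Torus d → ℝ → V} {K : ℝ≥0}

lemma lipschitzWith_time (hf : LipschitzWith K (fun z : Torus d × ℝ => f z.1 z.2)) (x : Torus d) :
    LipschitzWith K (f x) := by
  simpa only [mul_one, Function.comp_def] using hf.comp (LipschitzWith.prodMk_left x)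

lemma lipschitzWith_space (hf : LipschitzWith K (fun z : Torus d × ℝ => f z.1 z.2)) (t : ℝ) :
    LipschitzWith K (fun x => f x t) := by
  simpa only [mul_one, Function.comp_def] using hf.comp (LipschitzWith.prodMk_right t)

end Lipschitz

variable [NormedSpace ℝ V]

lemma lineDeriv_cover_time (f : Torus d → ℝ → V) (y : (Fin d → ℝ) × ℝ) :
    lineDeriv ℝ (fun y => f (Torus.cover d y).1 (Torus.cover d y).2) y (0, 1)
      = deriv (f (Torus.cover d y).1) (Torus.cover d y).2 := by
  have h := deriv_comp_const_add (f (Torus.mk y.1)) y.2 0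
  simpa [lineDeriv, Torus.cover_apply] using h

lemma lineDeriv_cover_space (f : Torus d → ℝ → V) (α : Fin d) (y : (Fin d → ℝ) × ℝ) :
    lineDeriv ℝ (fun y => f (Torus.cover d y).1 (Torus.cover d y).2) y (Pi.single α 1, 0)
      = pderiv α (fun x => f x (Torus.cover d y).2) (Torus.cover d y).1 := by
  simp [lineDeriv, pderiv, Torus.cover_apply, Torus.mk_add_smul_single]

lemma norm_pderiv_le {g : Torus d → V} {K : ℝ≥0} (hg : LipschitzWith K g) (α : Fin d)
    (x : Torus d) : ‖pderiv α g x‖ ≤ K := by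
  refine norm_deriv_le_of_lipschitz ?_
  simpa only [mul_one, Function.comp_def] using hg.comp (Torus.lipschitzWith_add_single α x)

lemma measurable_pderiv [MeasurableSpace V] [BorelSpace V] [CompleteSpace V] {f : Torus d → ℝ → V}
    (hf : Continuous (fun z : Torus d × ℝ => f z.1 z.2)) (α : Fin d) :
    Measurable (fun z : Torus d × ℝ => pderiv α (fun x => f x z.2) z.1) := by
  have hshift : Continuous fun w : (Torus d × ℝ) × ℝ =>
      (Pi.single α (w.2 : AddCircle (2 * Real.pi)) : Torus d) :=
    (continuous_single α).comp ((AddCircle.continuous_mk' _).comp continuous_snd)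
  have hcont : Continuous (Function.uncurry fun (z : Torus d × ℝ) (h : ℝ) =>
      f (z.1 + Pi.single α (h : AddCircle (2 * Real.pi))) z.2) :=
    hf.comp (((continuous_fst.comp continuous_fst).add hshift).prodMk
      (continuous_snd.comp continuous_fst))
  exact (measurable_deriv_with_param hcont).comp (measurable_id.prodMk measurable_const)

lemma ae_differentiableAt_lines [FiniteDimensional ℝ V] {f : Torus d → ℝ → V} {K : ℝ≥0}
    (hf : LipschitzWith K (fun z : Torus d × ℝ => f z.1 z.2)) :
    ∀ᵐ z : Torus d × ℝ, DifferentiableAt ℝ (f z.1) z.2 ∧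
      ∀ α, DifferentiableAt ℝ
        (fun h : ℝ => f (z.1 + Pi.single α (h : AddCircle (2 * Real.pi))) z.2) 0 := by
  refine ae_of_ae_cover ?_
  filter_upwards [(hf.comp Torus.lipschitzWith_cover).ae_differentiableAt] with y hy
  refine ⟨?_, fun α => ?_⟩
  · exact DifferentiableAt.comp (f := fun t : ℝ => (y.1, t)) y.2 hy (by fun_prop)
  · have hline := DifferentiableAt.comp (0 : ℝ)
      (f := fun h : ℝ => (y.1 + h • (Pi.single α 1 : Fin d → ℝ), y.2)) (by simpa using hy)
      (by fun_prop)
    simpa only [Function.comp_def, Torus.cover_apply, Torus.mk_add_smul_single] using hline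

end TorusCalculus

section TestApproximation

variable {d : ℕ} {T : ℝ} {K : ℝ≥0} {f : Torus d → ℝ → ℝ}

/-- `C¹` test functions `g k`, vanishing after time `T` and with a common Lipschitz constant `K`,
which converge to `f` together with almost all of their first derivatives. -/
structure IsTestApprox (T : ℝ) (K : ℝ≥0) (f : Torus d → ℝ → ℝ)
    (g : ℕ → Torus d → ℝ → ℝ) : Prop where
  contDiff : ∀ k, ContDiff ℝ 1 (fun y : (Fin d → ℝ) × ℝ => g k (Torus.mk y.1) y.2)
  lipschitz : ∀ k, LipschitzWith K (fun z : Torus d × ℝ => g k z.1 z.2)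
  eq_zero : ∀ k x, ∀ t ≥ T, g k x t = 0
  tendsto : ∀ x t, Tendsto (fun k => g k x t) atTop (𝓝 (f x t))
  ae_tendsto_deriv : ∀ᵐ z : Torus d × ℝ,
    Tendsto (fun k => deriv (g k z.1) z.2) atTop (𝓝 (deriv (f z.1) z.2))
  ae_tendsto_pderiv : ∀ᵐ z : Torus d × ℝ, ∀ α,
    Tendsto (fun k => pderiv α (fun y => g k y z.2) z.1) atTop
      (𝓝 (pderiv α (fun y => f y z.2) z.1))

lemma exists_isTestApprox (hf : LipschitzWith K (fun z : Torus d × ℝ => f z.1 z.2)) {T₁ : ℝ}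
    (hT₁ : T₁ < T) (hf0 : ∀ x, ∀ t ≥ T₁, f x t = 0) : ∃ g, IsTestApprox T K f g := by
  obtain ⟨N, hN⟩ := eventually_atTop.1 ((tendsto_shrinkingBump_rOut
    (E := (Fin d → ℝ) × ℝ)).eventually_le_const (sub_pos.2 hT₁))
  have hcover := (Torus.lipschitzWith_cover (d := d)).continuous
  have hlift : LipschitzWith K fun y => f (Torus.cover d y).1 (Torus.cover d y).2 := by
    simpa only [mul_one, Function.comp_def] using hf.comp Torus.lipschitzWith_cover
  set g : ℕ → Torus d → ℝ → ℝ := fun k x t =>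
    mollify volume (Torus.cover d) (fun z => f z.1 z.2) k (x, t)
  have hderiv := ae_tendsto_lineDeriv_mollify (μ := volume) (π := Torus.cover d)
    (f := fun z : Torus d × ℝ => f z.1 z.2) hlift
  have hcontDiff (k : ℕ) :
      ContDiff ℝ 1 fun y => g k (Torus.cover d y).1 (Torus.cover d y).2 :=
    contDiff_mollify_comp (f := fun z : Torus d × ℝ => f z.1 z.2) hlift.continuous k
  refine ⟨fun k => g (k + N), fun k => hcontDiff _,
    fun k => lipschitzWith_mollify hcover hf _, fun k x t ht => ?_,
    fun x t => (tendsto_mollify hcover hf.continuous (x, t)).comp (tendsto_add_atTop_nat N),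
    ae_of_ae_cover ?_, ae_of_ae_cover ?_⟩
  · refine mollify_eq_zero (f := fun z : Torus d × ℝ => f z.1 z.2) fun y hy => ?_
    have hsnd := (le_abs_self y.2).trans ((norm_snd_le y).trans (hy.le.trans (hN _ (by lia))))
    refine hf0 _ _ (?_ : T₁ ≤ t - y.2)
    linarith
  · filter_upwards [hderiv (0, 1)] with y hy
    rw [lineDeriv_cover_time f] at hy
    exact (hy.congr fun k => lineDeriv_cover_time (g k) y).comp (tendsto_add_atTop_nat N)
  · filter_upwards [ae_all_iff.2 fun α => hderiv (Pi.single α 1, 0)] with y hy α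
    have hα := hy α
    rw [lineDeriv_cover_space f] at hα
    exact (hα.congr fun k => lineDeriv_cover_space (g k) α y).comp (tendsto_add_atTop_nat N)

end TestApproximation

section Cylinder

variable {d : ℕ} {K : ℝ≥0} {T T' : ℝ}

lemma volume_restrict_cyl (T : ℝ) :
    (volume : Measure (Torus d × ℝ)).restrict (cyl d T)
      = (volume : Measure (Torus d)).prod (volume.restrict (Ico 0 T)) := by
  rw [cyl, Measure.volume_eq_prod, ← Measure.prod_restrict, Measure.restrict_univ]

instance isFiniteMeasure_restrict_cyl (T : ℝ) :
    IsFiniteMeasure ((volume : Measure (Torus d × ℝ)).restrict (cyl d T)) := by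
  rw [volume_restrict_cyl]
  infer_instance

lemma measurableSet_cyl (T : ℝ) : MeasurableSet (cyl d T) :=
  MeasurableSet.univ.prod measurableSet_Ico

lemma cyl_subset_cyl (h : T' ≤ T) : cyl d T' ⊆ cyl d T :=
  prod_mono le_rfl (Ico_subset_Ico_right h)

lemma le_of_mem_cyl_diff {z : Torus d × ℝ} (hz : z ∈ cyl d T \ cyl d T') : T' ≤ z.2 := by
  by_contra hlt
  exact hz.2 ⟨mem_univ _, hz.1.2.1, not_le.1 hlt⟩

lemma ae_restrict_cyl_of_forall_mem {p : Torus d × ℝ → Prop} (h : ∀ z ∈ cyl d T, p z) :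
    ∀ᵐ z ∂(volume.restrict (cyl d T)), p z :=
  (ae_restrict_iff' (measurableSet_cyl T)).2 (.of_forall h)

lemma integral_pderiv_eq_zero {g : Torus d → ℝ} (hg : LipschitzWith K g) (α : Fin d) :
    ∫ x, pderiv α g x = 0 := by
  have hdiff : ∀ᵐ x : Torus d, DifferentiableAt ℝ
      (fun h : ℝ => g (x + Pi.single α (h : AddCircle (2 * Real.pi)))) 0 := by
    have hfst : LipschitzWith K (fun z : Torus d × ℝ => g z.1) := by
      simpa only [mul_one, Function.comp_def] using hg.comp LipschitzWith.prod_fst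
    filter_upwards [Measure.ae_ae_of_ae_prod
      (ae_differentiableAt_lines (f := fun x _ => g x) hfst)] with x hx
    obtain ⟨t, ht⟩ := hx.exists
    exact ht.2 α
  have hlip (x : Torus d) :
      LipschitzWith K fun h : ℝ => g (x + Pi.single α (h : AddCircle (2 * Real.pi))) := by
    simpa only [mul_one, Function.comp_def] using hg.comp (Torus.lipschitzWith_add_single α x)
  have hcont (h : ℝ) : Continuous fun x : Torus d =>
      g (x + Pi.single α (h : AddCircle (2 * Real.pi))) := hg.continuous.comp (by fun_prop)
  have hmeas : Measurable (pderiv α g) :=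
    (measurable_pderiv (f := fun x (_ : ℝ) => g x) (hg.continuous.comp continuous_fst) α).comp
      (measurable_id.prodMk (measurable_const (a := (0 : ℝ))))
  have hderiv := (hasDerivAt_integral_of_dominated_loc_of_lip (μ := volume)
    (F := fun (h : ℝ) x => g (x + Pi.single α (h : AddCircle (2 * Real.pi)))) (x₀ := 0)
    (F' := pderiv α g) (bound := fun _ => K) univ_mem
    (.of_forall fun h => (hcont h).aestronglyMeasurable)
    ((hcont 0).integrable_of_hasCompactSupport (.of_compactSpace _))
    hmeas.aestronglyMeasurable
    (.of_forall fun x => by simpa only [Real.nnabs_coe] using (hlip x).lipschitzOnWith)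
    (integrable_const _)
    (hdiff.mono fun x hx => hx.hasDerivAt)).2
  simp only [integral_add_right_eq_self g] at hderiv
  exact hderiv.unique (hasDerivAt_const 0 _)

variable {f : Torus d → ℝ → ℝ}

lemma integrable_cyl_deriv (hf : LipschitzWith K (fun z : Torus d × ℝ => f z.1 z.2)) (T : ℝ) :
    Integrable (fun z : Torus d × ℝ => deriv (f z.1) z.2) (volume.restrict (cyl d T)) :=
  .of_bound (measurable_deriv_with_param hf.continuous).aestronglyMeasurable K
    (.of_forall fun z => norm_deriv_le_of_lipschitz (lipschitzWith_time hf z.1))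

lemma integrable_cyl_pderiv (hf : LipschitzWith K (fun z : Torus d × ℝ => f z.1 z.2)) (T : ℝ)
    (α : Fin d) :
    Integrable (fun z : Torus d × ℝ => pderiv α (fun y => f y z.2) z.1)
      (volume.restrict (cyl d T)) :=
  .of_bound (measurable_pderiv hf.continuous α).aestronglyMeasurable K
    (.of_forall fun z => norm_pderiv_le (lipschitzWith_space hf z.2) α z.1)

lemma integral_cyl_pderiv (hf : LipschitzWith K (fun z : Torus d × ℝ => f z.1 z.2)) (T : ℝ)
    (α : Fin d) : ∫ z in cyl d T, pderiv α (fun y => f y z.2) z.1 = 0 := by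
  have hint := integrable_cyl_pderiv hf T α
  rw [volume_restrict_cyl] at hint ⊢
  rw [integral_prod_symm _ hint]
  simp only [fun t => integral_pderiv_eq_zero (lipschitzWith_space hf t) α, integral_zero]

lemma integral_cyl_deriv (hf : LipschitzWith K (fun z : Torus d × ℝ => f z.1 z.2)) (hT : 0 ≤ T) :
    ∫ z in cyl d T, deriv (f z.1) z.2 = ∫ x, (f x T - f x 0) := by
  have hint := integrable_cyl_deriv hf T
  rw [volume_restrict_cyl] at hint ⊢
  rw [integral_prod _ hint]
  refine integral_congr_ae (.of_forall fun x => ?_)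
  have hac : AbsolutelyContinuousOnInterval (f x) 0 T :=
    (lipschitzWith_time hf x).lipschitzOnWith.absolutelyContinuousOnInterval
  simp only [integral_Ico_eq_integral_Ioc, ← intervalIntegral.integral_of_le hT,
    hac.integral_deriv_eq_sub]

end Cylinder

section CylWeight

variable {d : ℕ} {T T' T₁ C : ℝ} {w : Torus d × ℝ → ℝ}

/-- Bounded measurable scalar weights on `𝕋ᵈ × [0, ∞)` which vanish from time `T'` on: what is
needed of a test function, or of one of its derivatives, to multiply a locally integrable field. -/
structure IsCylWeight (T' C : ℝ) (w : Torus d × ℝ → ℝ) : Prop where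
  measurable : Measurable w
  bound : ∀ z ∈ cyl d T', |w z| ≤ C
  eq_zero : ∀ z, T' ≤ z.2 → w z = 0

section Smul

variable {V : Type*} [NormedAddCommGroup V] [NormedSpace ℝ V] {a : Torus d × ℝ → V}

lemma IsCylWeight.integrable_smul (hw : IsCylWeight T' C w)
    (ha : Integrable a (volume.restrict (cyl d T'))) :
    Integrable (fun z => w z • a z) (volume.restrict (cyl d T)) := by
  have hint : IntegrableOn (fun z => w z • a z) (cyl d T') :=
    ha.bdd_smul C hw.measurable.aestronglyMeasurable (ae_restrict_cyl_of_forall_mem hw.bound)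
  refine IntegrableOn.of_forall_sdiff_eq_zero hint (measurableSet_cyl T) fun z hz => ?_
  rw [hw.eq_zero z (le_of_mem_cyl_diff hz), zero_smul]

lemma IsCylWeight.setIntegral_smul_eq (hw : IsCylWeight T' C w) (hT : T' ≤ T) :
    ∫ z in cyl d T, w z • a z = ∫ z in cyl d T', w z • a z := by
  refine setIntegral_eq_of_subset_of_forall_sdiff_eq_zero (measurableSet_cyl T)
    (cyl_subset_cyl hT) fun z hz => ?_
  rw [hw.eq_zero z (le_of_mem_cyl_diff hz), zero_smul]

lemma IsCylWeight.tendsto_setIntegral_smul {v : ℕ → Torus d × ℝ → ℝ} (hw : IsCylWeight T' C w)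
    (hv : ∀ k, IsCylWeight T' C (v k)) (ha : Integrable a (volume.restrict (cyl d T')))
    (hT : T' ≤ T) (hlim : ∀ᵐ z, Tendsto (fun k => v k z) atTop (𝓝 (w z))) :
    Tendsto (fun k => ∫ z in cyl d T, v k z • a z) atTop (𝓝 (∫ z in cyl d T, w z • a z)) := by
  simp_rw [hw.setIntegral_smul_eq hT, fun k => (hv k).setIntegral_smul_eq (a := a) hT]
  refine tendsto_integral_of_dominated_convergence (fun z => C * ‖a z‖)
    (fun k => (hv k).measurable.aestronglyMeasurable.smul ha.aestronglyMeasurable)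
    (ha.norm.const_mul C) (fun k => ae_restrict_cyl_of_forall_mem fun z hz => ?_) ?_
  · rw [norm_smul]
    exact mul_le_mul_of_nonneg_right ((hv k).bound z hz) (norm_nonneg _)
  · filter_upwards [ae_restrict_of_ae hlim] with z hz using hz.smul_const _

end Smul

lemma deriv_eq_zero_of_eq_zero_of_le {θ : ℝ → ℝ} {t : ℝ} (h : ∀ t ≥ T₁, θ t = 0) (ht : T₁ < t) :
    deriv θ t = 0 := by
  have hθ : θ =ᶠ[𝓝 t] fun _ => 0 := by
    filter_upwards [lt_mem_nhds ht] with s hs using h s hs.le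
  rw [hθ.deriv_eq, deriv_const]

variable {K : ℝ≥0} {f : Torus d → ℝ → ℝ}

lemma abs_le_of_lipschitzWith_of_eq_zero
    (hf : LipschitzWith K (fun z : Torus d × ℝ => f z.1 z.2)) (h0 : ∀ x, ∀ t ≥ T₁, f x t = 0)
    (x : Torus d) (t : ℝ) : |f x t| ≤ K * |t - T₁| := by
  simpa only [Real.dist_eq, h0 x T₁ le_rfl, sub_zero] using
    (lipschitzWith_time hf x).dist_le_mul t T₁

lemma isCylWeight_self (hf : LipschitzWith K (fun z : Torus d × ℝ => f z.1 z.2))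
    (h0 : ∀ x, ∀ t ≥ T', f x t = 0) : IsCylWeight T' (K * T') fun z => f z.1 z.2 where
  measurable := hf.continuous.measurable
  bound z hz := by
    refine (abs_le_of_lipschitzWith_of_eq_zero hf h0 z.1 z.2).trans
      (mul_le_mul_of_nonneg_left ?_ K.coe_nonneg)
    rw [abs_of_nonpos (sub_nonpos.2 hz.2.2.le)]
    linarith [hz.2.1]
  eq_zero z := h0 z.1 z.2

lemma isCylWeight_deriv (hf : LipschitzWith K (fun z : Torus d × ℝ => f z.1 z.2))
    (h0 : ∀ x, ∀ t ≥ T₁, f x t = 0) (hT : T₁ < T') :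
    IsCylWeight T' K fun z => deriv (f z.1) z.2 where
  measurable := measurable_deriv_with_param hf.continuous
  bound z _ := norm_deriv_le_of_lipschitz (lipschitzWith_time hf z.1)
  eq_zero z hz := deriv_eq_zero_of_eq_zero_of_le (h0 z.1) (hT.trans_le hz)

lemma isCylWeight_pderiv (hf : LipschitzWith K (fun z : Torus d × ℝ => f z.1 z.2))
    (h0 : ∀ x, ∀ t ≥ T', f x t = 0) (α : Fin d) :
    IsCylWeight T' K fun z => pderiv α (fun y => f y z.2) z.1 where
  measurable := measurable_pderiv hf.continuous α
  bound z _ := norm_pderiv_le (lipschitzWith_space hf z.2) α z.1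
  eq_zero z hz := by simp [pderiv, fun x => h0 x z.2 hz]

end CylWeight

section WeakBalance

variable {d : ℕ} {T T₁ : ℝ} {K : ℝ≥0}

section Scalar

variable {V : Type*} [NormedAddCommGroup V] [NormedSpace ℝ V] {a c : Torus d × ℝ → V}
  {b : Fin d → Torus d × ℝ → V} {a₀ : Torus d → V} {φ : Torus d → ℝ → ℝ}

/-- The integrand `(∂_t φ) a + (∂_α φ) b_α + φ c` of the weak formulation of
`∂_t a + ∂_α b_α = c`. -/
noncomputable def weakIntegrand (a : Torus d × ℝ → V) (b : Fin d → Torus d × ℝ → V)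
    (c : Torus d × ℝ → V) (φ : Torus d → ℝ → ℝ) (z : Torus d × ℝ) : V :=
  deriv (φ z.1) z.2 • a z + ∑ α, pderiv α (fun y => φ y z.2) z.1 • b α z + φ z.1 z.2 • c z

/-- Weak solutions on `𝕋ᵈ × [0, T)` of a system of balance laws `∂_t a + ∂_α b_α = c` with
initial value `a₀`, with locally integrable entries. -/
structure IsWeakBalance (T : ℝ) (a : Torus d × ℝ → V) (b : Fin d → Torus d × ℝ → V)
    (c : Torus d × ℝ → V) (a₀ : Torus d → V) : Prop where
  integrable_a : ∀ T' < T, Integrable a (volume.restrict (cyl d T'))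
  integrable_b : ∀ T' < T, ∀ α, Integrable (b α) (volume.restrict (cyl d T'))
  integrable_c : ∀ T' < T, Integrable c (volume.restrict (cyl d T'))
  integrable_a₀ : Integrable a₀
  equation : ∀ φ : Torus d → ℝ → ℝ, IsTest T φ →
    (∫ z in cyl d T, deriv (φ z.1) z.2 • a z)
      + (∫ z in cyl d T, ∑ α, pderiv α (fun y => φ y z.2) z.1 • b α z)
      + (∫ z in cyl d T, φ z.1 z.2 • c z)
      + (∫ x, φ x 0 • a₀ x) = 0

namespace IsWeakBalance

lemma integrable_weakIntegrand (h : IsWeakBalance T a b c a₀)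
    (hφ : LipschitzWith K (fun z : Torus d × ℝ => φ z.1 z.2)) (hT₁ : T₁ < T)
    (h0 : ∀ x, ∀ t ≥ T₁, φ x t = 0) :
    Integrable (weakIntegrand a b c φ) (volume.restrict (cyl d T)) := by
  obtain ⟨T', hT', hT⟩ := exists_between hT₁
  have h0' : ∀ x, ∀ t ≥ T', φ x t = 0 := fun x t ht => h0 x t (hT'.le.trans ht)
  exact (((isCylWeight_deriv hφ h0 hT').integrable_smul (h.integrable_a T' hT)).add
    (integrable_finsetSum _ fun α _ =>
      (isCylWeight_pderiv hφ h0' α).integrable_smul (h.integrable_b T' hT α))).add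
    ((isCylWeight_self hφ h0').integrable_smul (h.integrable_c T' hT))

lemma integral_weakIntegrand (h : IsWeakBalance T a b c a₀)
    (hφ : LipschitzWith K (fun z : Torus d × ℝ => φ z.1 z.2)) (hT₁ : T₁ < T)
    (h0 : ∀ x, ∀ t ≥ T₁, φ x t = 0) :
    ∫ z in cyl d T, weakIntegrand a b c φ z
      = (∫ z in cyl d T, deriv (φ z.1) z.2 • a z)
        + (∑ α, ∫ z in cyl d T, pderiv α (fun y => φ y z.2) z.1 • b α z)
        + (∫ z in cyl d T, φ z.1 z.2 • c z) := by
  obtain ⟨T', hT', hT⟩ := exists_between hT₁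
  have h0' : ∀ x, ∀ t ≥ T', φ x t = 0 := fun x t ht => h0 x t (hT'.le.trans ht)
  have ha := (isCylWeight_deriv hφ h0 hT').integrable_smul (T := T) (h.integrable_a T' hT)
  have hb := fun α =>
    (isCylWeight_pderiv hφ h0' α).integrable_smul (T := T) (h.integrable_b T' hT α)
  have hc := (isCylWeight_self hφ h0').integrable_smul (T := T) (h.integrable_c T' hT)
  have hsum := integrable_finsetSum Finset.univ fun α _ => hb α
  rw [← integral_finsetSum _ fun α _ => hb α, ← integral_add ha hsum]
  exact integral_add (ha.add hsum) hc

lemma tendsto_integral_weakIntegrand (h : IsWeakBalance T a b c a₀)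
    (hφ : LipschitzWith K (fun z : Torus d × ℝ => φ z.1 z.2)) (hT₁ : T₁ < T)
    (h0 : ∀ x, ∀ t ≥ T₁, φ x t = 0) {g : ℕ → Torus d → ℝ → ℝ} (hg : IsTestApprox T₁ K φ g) :
    Tendsto (fun k => ∫ z in cyl d T, weakIntegrand a b c (g k) z) atTop
      (𝓝 (∫ z in cyl d T, weakIntegrand a b c φ z)) := by
  obtain ⟨T', hT', hT⟩ := exists_between hT₁
  have h0' : ∀ x, ∀ t ≥ T', φ x t = 0 := fun x t ht => h0 x t (hT'.le.trans ht)
  have hg0 (k : ℕ) : ∀ x, ∀ t ≥ T', g k x t = 0 := fun x t ht =>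
    hg.eq_zero k x t (hT'.le.trans ht)
  simp only [h.integral_weakIntegrand hφ hT₁ h0,
    fun k => h.integral_weakIntegrand (hg.lipschitz k) hT₁ (hg.eq_zero k)]
  refine (Tendsto.add ?_ (tendsto_finsetSum _ fun α _ => ?_)).add ?_
  · exact (isCylWeight_deriv hφ h0 hT').tendsto_setIntegral_smul
      (fun k => isCylWeight_deriv (hg.lipschitz k) (hg.eq_zero k) hT') (h.integrable_a T' hT)
      hT.le hg.ae_tendsto_deriv
  · exact (isCylWeight_pderiv hφ h0' α).tendsto_setIntegral_smul
      (fun k => isCylWeight_pderiv (hg.lipschitz k) (hg0 k) α) (h.integrable_b T' hT α)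
      hT.le (hg.ae_tendsto_pderiv.mono fun z hz => hz α)
  · exact (isCylWeight_self hφ h0').tendsto_setIntegral_smul
      (fun k => isCylWeight_self (hg.lipschitz k) (hg0 k)) (h.integrable_c T' hT)
      hT.le (.of_forall fun z => hg.tendsto z.1 z.2)

lemma integrable_initial (h : IsWeakBalance T a b c a₀)
    (hφ : LipschitzWith K (fun z : Torus d × ℝ => φ z.1 z.2)) (h0 : ∀ x, ∀ t ≥ T₁, φ x t = 0) :
    Integrable fun x => φ x 0 • a₀ x :=
  h.integrable_a₀.bdd_smul (K * |0 - T₁|)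
    (lipschitzWith_space hφ 0).continuous.aestronglyMeasurable
    (.of_forall fun x => abs_le_of_lipschitzWith_of_eq_zero hφ h0 x 0)

lemma tendsto_integral_initial (h : IsWeakBalance T a b c a₀) {g : ℕ → Torus d → ℝ → ℝ}
    (hg : IsTestApprox T₁ K φ g) :
    Tendsto (fun k => ∫ x, g k x 0 • a₀ x) atTop (𝓝 (∫ x, φ x 0 • a₀ x)) := by
  refine tendsto_integral_of_dominated_convergence (fun x => K * |0 - T₁| * ‖a₀ x‖)
    (fun k => (h.integrable_initial (hg.lipschitz k) (hg.eq_zero k)).aestronglyMeasurable)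
    (h.integrable_a₀.norm.const_mul _) (fun k => .of_forall fun x => ?_)
    (.of_forall fun x => (hg.tendsto x 0).smul_const _)
  rw [norm_smul]
  exact mul_le_mul_of_nonneg_right
    (abs_le_of_lipschitzWith_of_eq_zero (hg.lipschitz k) (hg.eq_zero k) x 0) (norm_nonneg _)

lemma integral_weakIntegrand_of_isTest (h : IsWeakBalance T a b c a₀)
    (hφ : LipschitzWith K (fun z : Torus d × ℝ => φ z.1 z.2)) (htest : IsTest T φ) :
    (∫ z in cyl d T, weakIntegrand a b c φ z) + ∫ x, φ x 0 • a₀ x = 0 := by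
  obtain ⟨T₁, hT₁, h0⟩ := htest.support
  obtain ⟨T', hT', hT⟩ := exists_between hT₁
  rw [h.integral_weakIntegrand hφ hT₁ h0, ← integral_finsetSum _ fun α _ =>
    (isCylWeight_pderiv hφ (fun x t ht => h0 x t (hT'.le.trans ht)) α).integrable_smul
      (h.integrable_b T' hT α)]
  exact h.equation φ htest

theorem lipschitz_test (h : IsWeakBalance T a b c a₀)
    (hφ : LipschitzWith K (fun z : Torus d × ℝ => φ z.1 z.2)) (hT₁ : T₁ < T)
    (h0 : ∀ x, ∀ t ≥ T₁, φ x t = 0) :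
    (∫ z in cyl d T, weakIntegrand a b c φ z) + ∫ x, φ x 0 • a₀ x = 0 := by
  obtain ⟨T₂, hT₁₂, hT₂⟩ := exists_between hT₁
  obtain ⟨g, hg⟩ := exists_isTestApprox hφ hT₁₂ h0
  have hzero (k : ℕ) := h.integral_weakIntegrand_of_isTest (hg.lipschitz k)
    ⟨hg.contDiff k, T₂, hT₂, hg.eq_zero k⟩
  have hlim := (h.tendsto_integral_weakIntegrand hφ hT₂
    (fun x t ht => h0 x t (hT₁₂.le.trans ht)) hg).add (h.tendsto_integral_initial hg)
  simp only [hzero] at hlim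
  exact tendsto_nhds_unique hlim tendsto_const_nhds

end IsWeakBalance

end Scalar

variable {n : ℕ} {a c : Torus d × ℝ → State n} {b : Fin d → Torus d × ℝ → State n}
  {a₀ : Torus d → State n} {Γ : Torus d → ℝ → State n}

/-- The integrand `∂_t Γ · a + ∂_α Γ · b_α + Γ · c` of the weak formulation of
`∂_t a + ∂_α b_α = c` with a vector-valued test function. -/
noncomputable def weakPairing (a : Torus d × ℝ → State n) (b : Fin d → Torus d × ℝ → State n)
    (c : Torus d × ℝ → State n) (Γ : Torus d → ℝ → State n) (z : Torus d × ℝ) : ℝ :=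
  inner ℝ (deriv (Γ z.1) z.2) (a z)
    + ∑ α, inner ℝ (pderiv α (fun y => Γ y z.2) z.1) (b α z) + inner ℝ (Γ z.1 z.2) (c z)

lemma ae_weakPairing_eq_sum (hΓ : LipschitzWith K (fun z : Torus d × ℝ => Γ z.1 z.2)) :
    ∀ᵐ z, weakPairing a b c Γ z = ∑ i, weakIntegrand a b c (fun x t => Γ x t i) z i := by
  filter_upwards [ae_differentiableAt_lines hΓ] with z hz
  have hderiv (i : Fin n) : deriv (fun t => Γ z.1 t i) z.2 = deriv (Γ z.1) z.2 i :=
    ((EuclideanSpace.proj i : State n →L[ℝ] ℝ).hasFDerivAt.comp_hasDerivAt z.2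
      hz.1.hasDerivAt).deriv
  have hpderiv (i : Fin n) (α : Fin d) :
      pderiv α (fun y => Γ y z.2 i) z.1 = pderiv α (fun y => Γ y z.2) z.1 i :=
    ((EuclideanSpace.proj i : State n →L[ℝ] ℝ).hasFDerivAt.comp_hasDerivAt (0 : ℝ)
      (hz.2 α).hasDerivAt).deriv
  simp only [weakPairing, weakIntegrand, hderiv, hpderiv, PiLp.inner_apply, PiLp.add_apply,
    PiLp.smul_apply, smul_eq_mul, WithLp.ofLp_sum, Finset.sum_apply, RCLike.inner_apply,
    conj_trivial, Finset.sum_add_distrib]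
  rw [Finset.sum_comm]
  simp only [mul_comm]

lemma lipschitzWith_component (hΓ : LipschitzWith K (fun z : Torus d × ℝ => Γ z.1 z.2))
    (i : Fin n) : LipschitzWith K (fun z : Torus d × ℝ => Γ z.1 z.2 i) :=
  LipschitzWith.of_dist_le_mul fun z w => by
    refine le_trans ?_ (hΓ.dist_le_mul z w)
    simpa only [dist_eq_norm, PiLp.sub_apply] using PiLp.norm_apply_le (Γ z.1 z.2 - Γ w.1 w.2) i

theorem IsWeakBalance.lipschitz_test_inner (h : IsWeakBalance T a b c a₀)
    (hΓ : LipschitzWith K (fun z : Torus d × ℝ => Γ z.1 z.2)) (hT₁ : T₁ < T)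
    (h0 : ∀ x, ∀ t ≥ T₁, Γ x t = 0) :
    Integrable (weakPairing a b c Γ) (volume.restrict (cyl d T)) ∧
      (∫ z in cyl d T, weakPairing a b c Γ z) + ∫ x, inner ℝ (Γ x 0) (a₀ x) = 0 := by
  have hlip := lipschitzWith_component hΓ
  have h0' (i : Fin n) : ∀ x, ∀ t ≥ T₁, Γ x t i = 0 := fun x t ht => by simp [h0 x t ht]
  have hint (i : Fin n) := h.integrable_weakIntegrand (hlip i) hT₁ (h0' i)
  have hint₀ (i : Fin n) := h.integrable_initial (hlip i) (h0' i)
  have hproj (i : Fin n) := (EuclideanSpace.proj i : State n →L[ℝ] ℝ).integrable_comp (hint i)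
  have hproj₀ (i : Fin n) := (EuclideanSpace.proj i : State n →L[ℝ] ℝ).integrable_comp (hint₀ i)
  have hae := ae_restrict_of_ae (s := cyl d T)
    (ae_weakPairing_eq_sum (a := a) (b := b) (c := c) hΓ)
  refine ⟨(integrable_finsetSum Finset.univ fun i _ => hproj i).congr
    (hae.mono fun z hz => hz.symm), ?_⟩
  have hinner (x : Torus d) : (inner ℝ (Γ x 0) (a₀ x) : ℝ)
      = ∑ i, (EuclideanSpace.proj i : State n →L[ℝ] ℝ) (Γ x 0 i • a₀ x) := by
    simp [PiLp.inner_apply, mul_comm]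
  simp only [hinner]
  rw [integral_congr_ae hae]
  refine (congrArg₂ (· + ·) (integral_finsetSum _ fun i _ => hproj i)
    (integral_finsetSum _ fun i _ => hproj₀ i)).trans ?_
  rw [← Finset.sum_add_distrib]
  refine Finset.sum_eq_zero fun i _ => ?_
  rw [ContinuousLinearMap.integral_comp_comm _ (hint i),
    ContinuousLinearMap.integral_comp_comm _ (hint₀ i), ← map_add,
    h.lipschitz_test (hlip i) hT₁ (h0' i), map_zero]

end WeakBalance

section LocalBounds

lemma fderiv_fderiv_apply {E F : Type*} [NormedAddCommGroup E] [NormedSpace ℝ E]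
    [NormedAddCommGroup F] [NormedSpace ℝ F] {h : E → F} (hh : ContDiff ℝ 2 h) (v ξ ζ : E) :
    fderiv ℝ (fun w => fderiv ℝ h w ζ) v ξ = fderiv ℝ (fderiv ℝ h) v ξ ζ := by
  rw [fderiv_clm_apply ((hh.fderiv_right (m := 1) (by norm_num)).differentiable one_ne_zero v)
    (differentiableAt_const ζ)]
  simp

variable {E F : Type*} [NormedAddCommGroup E] [NormedSpace ℝ E] [FiniteDimensional ℝ E]
  [NormedAddCommGroup F]

lemma exists_norm_le_on_ball {h : E → F} (hh : Continuous h) (R : ℝ) :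
    ∃ C, 0 ≤ C ∧ ∀ v, ‖v‖ ≤ R → ‖h v‖ ≤ C := by
  have := FiniteDimensional.proper ℝ E
  obtain ⟨C, hC⟩ := (isCompact_closedBall (0 : E) R).exists_bound_of_continuousOn hh.continuousOn
  exact ⟨max C 0, le_max_right _ _, fun v hv =>
    (hC v (mem_closedBall_zero_iff.2 hv)).trans (le_max_left _ _)⟩

lemma exists_norm_le_mul_one_add {h : E → F} {H : E → ℝ} (hh : Continuous h) (hH : ∀ v, 0 ≤ H v)
    (ho : h =o[Bornology.cobounded E] H) : ∃ C, 0 ≤ C ∧ ∀ u, ‖h u‖ ≤ C * (1 + H u) := by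
  obtain ⟨R, -, hR⟩ := (Metric.hasBasis_cobounded_compl_closedBall (0 : E)).eventually_iff.1
    (ho.def one_pos)
  obtain ⟨C, hC, hball⟩ := exists_norm_le_on_ball hh R
  refine ⟨C + 1, by positivity, fun u => ?_⟩
  have hu := hH u
  rcases le_or_gt ‖u‖ R with hle | hgt
  · nlinarith [hball u hle]
  · have hfar := hR (x := u) (by simpa using hgt)
    rw [Real.norm_of_nonneg hu, one_mul] at hfar
    nlinarith

variable [NormedSpace ℝ F]

lemma exists_lipschitz_on_ball {h : E → F} (hh : ContDiff ℝ 1 h) (R : ℝ) :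
    ∃ L, 0 ≤ L ∧ ∀ u v, ‖u‖ ≤ R → ‖v‖ ≤ R → ‖h u - h v‖ ≤ L * ‖u - v‖ := by
  obtain ⟨C, hC0, hC⟩ := exists_norm_le_on_ball (hh.continuous_fderiv one_ne_zero) R
  exact ⟨C, hC0, fun u v hu hv =>
    (convex_closedBall (0 : E) R).norm_image_sub_le_of_norm_fderiv_le (𝕜 := ℝ)
      (fun x _ => hh.differentiable one_ne_zero x)
      (fun x hx => hC x (mem_closedBall_zero_iff.1 hx)) (mem_closedBall_zero_iff.2 hv)
      (mem_closedBall_zero_iff.2 hu)⟩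

lemma exists_norm_taylor_le_on_ball {h : E → F} (hh : ContDiff ℝ 2 h) (R : ℝ) :
    ∃ L, 0 ≤ L ∧ ∀ u v, ‖u‖ ≤ R → ‖v‖ ≤ R →
      ‖h u - h v - fderiv ℝ h v (u - v)‖ ≤ L * ‖u - v‖ ^ 2 := by
  obtain ⟨L, hL0, hL⟩ := exists_lipschitz_on_ball (hh.fderiv_right (m := 1) (by norm_num)) R
  refine ⟨L, hL0, fun u v hu hv => ?_⟩
  have hseg : segment ℝ v u ⊆ Metric.closedBall 0 R :=
    (convex_closedBall (0 : E) R).segment_subset (mem_closedBall_zero_iff.2 hv)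
      (mem_closedBall_zero_iff.2 hu)
  rw [sq, ← mul_assoc]
  exact (convex_segment v u).norm_image_sub_le_of_norm_hasFDerivWithin_le' (𝕜 := ℝ)
    (f' := fderiv ℝ h)
    (fun x _ => (hh.differentiable two_ne_zero x).hasFDerivAt.hasFDerivWithinAt)
    (fun x hx => (hL x v (mem_closedBall_zero_iff.1 (hseg hx)) hv).trans
      (mul_le_mul_of_nonneg_left (norm_sub_le_of_mem_segment hx) hL0))
    (left_mem_segment ℝ v u) (right_mem_segment ℝ v u)

lemma fderiv_gradient_symm {φ : E → ℝ} {φ' : E → E →L[ℝ] ℝ} (h : ∀ v, HasFDerivAt φ (φ' v) v)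
    (h' : ∀ ζ, ContDiff ℝ 1 (fun v => φ' v ζ)) (v ξ ζ : E) :
    fderiv ℝ (fun w => φ' w ζ) v ξ = fderiv ℝ (fun w => φ' w ξ) v ζ := by
  have hd : DifferentiableAt ℝ φ' v :=
    (contDiff_clm_apply_iff.2 h').differentiable one_ne_zero v
  have happly (ξ ζ : E) : fderiv ℝ (fun w => φ' w ζ) v ξ = fderiv ℝ φ' v ξ ζ := by
    rw [fderiv_clm_apply hd (differentiableAt_const ζ)]
    simp
  rw [happly, happly]
  exact second_derivative_symmetric h hd.hasFDerivAt ξ ζ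

end LocalBounds

section RelativeEntropy

variable {E F : Type*} [NormedAddCommGroup E] [InnerProductSpace ℝ E]
  [NormedAddCommGroup F]

/-- The relative entropy `H(u | v)` of an entropy `H` with gradient `g`. -/
noncomputable def relEntropy (H : E → ℝ) (g : E → E) (u v : E) : ℝ :=
  H u - H v - inner ℝ (g v) (u - v)

/-- The production `P` is dissipative up to a multiple of the relative entropy, uniformly for the
second argument in a ball; this is what either alternative on the production provides. -/
def RelativelyDissipative (H : E → ℝ) (g P : E → E) : Prop :=
  ∀ M, ∃ C, 0 ≤ C ∧ ∀ u v, ‖v‖ ≤ M →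
    (inner ℝ (g u - g v) (P u - P v) : ℝ) ≤ C * relEntropy H g u v

/-- A nonnegative entropy `H` with gradient `g` and positive definite Hessian, which at infinity
dominates the identity and `g`. -/
structure CoerciveEntropy (H : E → ℝ) (g : E → E) : Prop where
  contDiff_g : ContDiff ℝ 2 g
  grad_H : ∀ v, HasFDerivAt H (innerSL ℝ (g v)) v
  pos_def : ∀ v ξ, ξ ≠ 0 → 0 < (inner ℝ (fderiv ℝ g v ξ) ξ : ℝ)
  nonneg : ∀ v, 0 ≤ H v
  growth_id : (fun v => v) =o[Bornology.cobounded E] H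
  growth_g : g =o[Bornology.cobounded E] H

namespace CoerciveEntropy

variable {H : E → ℝ} {g : E → E}

lemma contDiff_H (hs : CoerciveEntropy H g) : ContDiff ℝ 1 H :=
  contDiff_one_iff_hasFDerivAt.2
    ⟨_, (innerSL ℝ).continuous.comp hs.contDiff_g.continuous, hs.grad_H⟩

lemma differentiable_g (hs : CoerciveEntropy H g) : Differentiable ℝ g :=
  hs.contDiff_g.differentiable two_ne_zero

variable [FiniteDimensional ℝ E]

lemma hessian_symm (hs : CoerciveEntropy H g) (v ξ ζ : E) :
    (inner ℝ (fderiv ℝ g v ξ) ζ : ℝ) = inner ℝ (fderiv ℝ g v ζ) ξ := by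
  have h := fderiv_gradient_symm hs.grad_H (fun ζ => by
    simpa only [innerSL_apply_apply] using
      (hs.contDiff_g.of_le one_le_two).inner ℝ contDiff_const) v ξ ζ
  simp only [innerSL_apply_apply] at h
  rw [fderiv_inner_apply ℝ (hs.differentiable_g v) (differentiableAt_const ζ),
    fderiv_inner_apply ℝ (hs.differentiable_g v) (differentiableAt_const ξ)] at h
  simpa using h

lemma exists_mul_sq_le_hessian_on_ball (hs : CoerciveEntropy H g) (R : ℝ) :
    ∃ c, 0 < c ∧ ∀ v, ‖v‖ ≤ R → ∀ ξ, c * ‖ξ‖ ^ 2 ≤ inner ℝ (fderiv ℝ g v ξ) ξ := by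
  have := FiniteDimensional.proper ℝ E
  set S := Metric.closedBall (0 : E) R ×ˢ Metric.sphere (0 : E) 1
  have hcont : Continuous fun p : E × E => (inner ℝ (fderiv ℝ g p.1 p.2) p.2 : ℝ) :=
    (((hs.contDiff_g.continuous_fderiv two_ne_zero).comp continuous_fst).clm_apply
      continuous_snd).inner continuous_snd
  obtain ⟨c, hc, hmin⟩ :=
    ((isCompact_closedBall (0 : E) R).prod (isCompact_sphere (0 : E) 1)).exists_forall_le'
      hcont.continuousOn (a := 0) fun p hp => hs.pos_def p.1 p.2
        (ne_zero_of_mem_unit_sphere (⟨p.2, hp.2⟩ : Metric.sphere (0 : E) 1))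
  refine ⟨c, hc, fun v hv ξ => ?_⟩
  rcases eq_or_ne ξ 0 with rfl | hξ
  · simp
  have hξ' : ‖ξ‖ ≠ 0 := norm_ne_zero_iff.2 hξ
  have hunit := hmin (v, ‖ξ‖⁻¹ • ξ) ⟨mem_closedBall_zero_iff.2 hv, by simp [norm_smul, hξ']⟩
  simp only [map_smul, real_inner_smul_left, real_inner_smul_right] at hunit
  calc c * ‖ξ‖ ^ 2 ≤ (‖ξ‖⁻¹ * (‖ξ‖⁻¹ * inner ℝ (fderiv ℝ g v ξ) ξ)) * ‖ξ‖ ^ 2 := by gcongr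
    _ = inner ℝ (fderiv ℝ g v ξ) ξ := by field_simp

lemma exists_mul_sq_le_inner_sub_on_ball (hs : CoerciveEntropy H g) (R : ℝ) :
    ∃ c, 0 < c ∧ ∀ u v, ‖u‖ ≤ R → ‖v‖ ≤ R →
      c * ‖u - v‖ ^ 2 ≤ inner ℝ (g u - g v) (u - v) := by
  obtain ⟨c, hc, hpos⟩ := hs.exists_mul_sq_le_hessian_on_ball R
  refine ⟨c, hc, fun u v hu hv => ?_⟩
  have hderiv (s : ℝ) : HasDerivAt
      (fun s => (inner ℝ (g (AffineMap.lineMap v u s)) (u - v) : ℝ))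
      (inner ℝ (fderiv ℝ g (AffineMap.lineMap v u s) (u - v)) (u - v)) s := by
    simpa using ((hs.differentiable_g _).hasFDerivAt.comp_hasDerivAt s
      AffineMap.hasDerivAt_lineMap).inner ℝ (hasDerivAt_const s (u - v))
  have hslope := (convex_Icc (0 : ℝ) 1).mul_sub_le_image_sub_of_le_deriv
    (fun s _ => (hderiv s).continuousAt.continuousWithinAt)
    (fun s _ => (hderiv s).differentiableAt.differentiableWithinAt)
    (C := c * ‖u - v‖ ^ 2) (fun s hs' => ?_) 0 (left_mem_Icc.2 zero_le_one) 1
    (right_mem_Icc.2 zero_le_one) zero_le_one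
  · simpa [inner_sub_left] using hslope
  · rw [(hderiv s).deriv]
    exact hpos _ (mem_closedBall_zero_iff.1 ((convex_closedBall (0 : E) R).lineMap_mem
      (mem_closedBall_zero_iff.2 hv) (mem_closedBall_zero_iff.2 hu) (interior_subset hs'))) _

lemma exists_mul_sq_le_relEntropy_on_ball (hs : CoerciveEntropy H g) (R : ℝ) :
    ∃ c, 0 < c ∧ ∀ u v, ‖u‖ ≤ R → ‖v‖ ≤ R → c * ‖u - v‖ ^ 2 ≤ relEntropy H g u v := by
  obtain ⟨c, hc, hmono⟩ := hs.exists_mul_sq_le_inner_sub_on_ball R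
  refine ⟨c / 2, by positivity, fun u v hu hv => ?_⟩
  have hderiv (s : ℝ) : HasDerivAt
      (fun s => H (AffineMap.lineMap v u s) - s * inner ℝ (g v) (u - v)
        - c / 2 * ‖u - v‖ ^ 2 * s ^ 2)
      (inner ℝ (g (AffineMap.lineMap v u s) - g v) (u - v) - c * ‖u - v‖ ^ 2 * s) s := by
    refine ((((hs.grad_H _).comp_hasDerivAt s AffineMap.hasDerivAt_lineMap).sub
      ((hasDerivAt_id s).mul_const (inner ℝ (g v) (u - v) : ℝ))).sub
      ((hasDerivAt_pow 2 s).const_mul (c / 2 * ‖u - v‖ ^ 2))).congr_deriv ?_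
    simp only [innerSL_apply_apply, one_mul, Nat.cast_ofNat, inner_sub_left]
    ring
  have hslope := (convex_Icc (0 : ℝ) 1).mul_sub_le_image_sub_of_le_deriv
    (fun s _ => (hderiv s).continuousAt.continuousWithinAt)
    (fun s _ => (hderiv s).differentiableAt.differentiableWithinAt) (C := 0)
    (fun s hs' => ?_) 0 (left_mem_Icc.2 zero_le_one) 1 (right_mem_Icc.2 zero_le_one) zero_le_one
  · norm_num at hslope
    rw [relEntropy]
    linarith
  · rw [interior_Icc] at hs'
    rw [(hderiv s).deriv]
    have hle := hmono _ v (mem_closedBall_zero_iff.1 ((convex_closedBall (0 : E) R).lineMap_mem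
      (mem_closedBall_zero_iff.2 hv) (mem_closedBall_zero_iff.2 hu)
      (Ioo_subset_Icc_self hs'))) hv
    rw [← vsub_eq_sub (AffineMap.lineMap v u s), AffineMap.lineMap_vsub_left, vsub_eq_sub,
      norm_smul, Real.norm_of_nonneg hs'.1.le, real_inner_smul_right] at hle
    refine le_of_mul_le_mul_left ?_ hs'.1
    linarith

lemma relEntropy_nonneg (hs : CoerciveEntropy H g) (u v : E) : 0 ≤ relEntropy H g u v := by
  obtain ⟨c, hc, h⟩ := hs.exists_mul_sq_le_relEntropy_on_ball (max ‖u‖ ‖v‖)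
  exact le_trans (by positivity) (h u v (le_max_left _ _) (le_max_right _ _))

lemma eq_of_relEntropy_eq_zero (hs : CoerciveEntropy H g) {u v : E}
    (h0 : relEntropy H g u v = 0) : u = v := by
  obtain ⟨c, hc, h⟩ := hs.exists_mul_sq_le_relEntropy_on_ball (max ‖u‖ ‖v‖)
  have hle := h u v (le_max_left _ _) (le_max_right _ _)
  rw [h0] at hle
  have hsq : ‖u - v‖ ^ 2 = 0 := le_antisymm (nonpos_of_mul_nonpos_right hle hc) (sq_nonneg _)
  exact sub_eq_zero.1 (norm_eq_zero.1 (sq_eq_zero_iff.1 hsq))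

lemma exists_le_relEntropy_of_large (hs : CoerciveEntropy H g) (M : ℝ) :
    ∃ R, M ≤ R ∧ ∀ u v, ‖v‖ ≤ M → R < ‖u‖ → 1 / 8 * (1 + H u) ≤ relEntropy H g u v := by
  obtain ⟨C₁, hC₁, h₁⟩ := exists_norm_le_on_ball (h := fun v => H v - inner ℝ (g v) v)
    (hs.contDiff_H.continuous.sub (hs.contDiff_g.continuous.inner continuous_id)) M
  obtain ⟨C₂, hC₂, h₂⟩ := exists_norm_le_on_ball hs.contDiff_g.continuous M
  obtain ⟨R, -, hR⟩ := (Metric.hasBasis_cobounded_compl_closedBall (0 : E)).eventually_iff.1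
    ((hs.growth_id.def (c := 1 / (2 * (C₂ + 1))) (by positivity)).and (hs.growth_id.def one_pos))
  refine ⟨max (max R M) (4 * C₁ + 1), (le_max_right _ _).trans (le_max_left _ _),
    fun u v hv hu => ?_⟩
  obtain ⟨⟨hRu, -⟩, hCu⟩ := (max_lt_iff.1 hu).imp_left max_lt_iff.1
  obtain ⟨hsmall, hle⟩ := hR (x := u) (by simpa using hRu)
  rw [Real.norm_of_nonneg (hs.nonneg u)] at hsmall hle
  have hinner : (inner ℝ (g v) u : ℝ) ≤ H u / 2 :=
    calc (inner ℝ (g v) u : ℝ) ≤ ‖g v‖ * ‖u‖ := real_inner_le_norm _ _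
      _ ≤ (C₂ + 1) * (1 / (2 * (C₂ + 1)) * H u) := by
          gcongr
          linarith [h₂ v hv]
      _ = H u / 2 := by field_simp
  have hv' := (Real.le_norm_self _).trans (h₁ v hv)
  rw [relEntropy, inner_sub_right]
  linarith

lemma exists_le_mul_relEntropy (hs : CoerciveEntropy H g) {M : ℝ} {s : E → E → ℝ}
    (hloc : ∀ R, ∃ L, 0 ≤ L ∧ ∀ u v, ‖u‖ ≤ R → ‖v‖ ≤ R → s u v ≤ L * ‖u - v‖ ^ 2)
    (hglob : ∃ C, 0 ≤ C ∧ ∀ u v, ‖v‖ ≤ M → s u v ≤ C * (1 + H u)) :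
    ∃ C, 0 ≤ C ∧ ∀ u v, ‖v‖ ≤ M → s u v ≤ C * relEntropy H g u v := by
  obtain ⟨R, hMR, hR⟩ := hs.exists_le_relEntropy_of_large M
  obtain ⟨c, hc, hcR⟩ := hs.exists_mul_sq_le_relEntropy_on_ball R
  obtain ⟨L, hL, hloc⟩ := hloc R
  obtain ⟨C, hC, hglob⟩ := hglob
  refine ⟨L / c + 8 * C, by positivity, fun u v hv => ?_⟩
  have hnonneg := hs.relEntropy_nonneg u v
  rw [add_mul]
  rcases le_or_gt ‖u‖ R with hu | hu
  · refine le_add_of_le_of_nonneg ?_ (by positivity)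
    calc s u v ≤ L * ‖u - v‖ ^ 2 := hloc u v hu (hv.trans hMR)
      _ = L / c * (c * ‖u - v‖ ^ 2) := by field_simp
      _ ≤ L / c * relEntropy H g u v := by gcongr; exact hcR u v hu (hv.trans hMR)
  · refine le_add_of_nonneg_of_le (by positivity) ?_
    calc s u v ≤ C * (1 + H u) := hglob u v hv
      _ = 8 * C * (1 / 8 * (1 + H u)) := by ring
      _ ≤ 8 * C * relEntropy H g u v := by gcongr; exact hR u v hv hu

lemma exists_norm_sub_le_mul_one_add (hs : CoerciveEntropy H g) {h : E → F} (hh : Continuous h)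
    (ho : h =o[Bornology.cobounded E] H) (M : ℝ) :
    ∃ C, 0 ≤ C ∧ ∀ u v, ‖v‖ ≤ M → ‖h u - h v‖ ≤ C * (1 + H u) := by
  obtain ⟨C₁, hC₁, h₁⟩ := exists_norm_le_mul_one_add hh hs.nonneg ho
  obtain ⟨C₂, hC₂, h₂⟩ := exists_norm_le_on_ball hh M
  refine ⟨C₁ + C₂, by positivity, fun u v hv => (norm_sub_le _ _).trans ?_⟩
  nlinarith [h₁ u, h₂ v hv, hs.nonneg u]

lemma exists_norm_taylor_le_relEntropy [NormedSpace ℝ F] (hs : CoerciveEntropy H g) {h : E → F}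
    (hh : ContDiff ℝ 2 h) (ho : h =o[Bornology.cobounded E] H) (M : ℝ) :
    ∃ C, 0 ≤ C ∧ ∀ u v, ‖v‖ ≤ M →
      ‖h u - h v - fderiv ℝ h v (u - v)‖ ≤ C * relEntropy H g u v := by
  refine hs.exists_le_mul_relEntropy (s := fun u v => ‖h u - h v - fderiv ℝ h v (u - v)‖)
    (exists_norm_taylor_le_on_ball hh) ?_
  obtain ⟨C₁, hC₁, h₁⟩ := hs.exists_norm_sub_le_mul_one_add hh.continuous ho M
  obtain ⟨C₂, hC₂, h₂⟩ := hs.exists_norm_sub_le_mul_one_add continuous_id hs.growth_id M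
  obtain ⟨C₃, hC₃, h₃⟩ := exists_norm_le_on_ball (hh.continuous_fderiv two_ne_zero) M
  refine ⟨C₁ + C₃ * C₂, by positivity, fun u v hv => ?_⟩
  calc ‖h u - h v - fderiv ℝ h v (u - v)‖
      ≤ ‖h u - h v‖ + ‖fderiv ℝ h v‖ * ‖u - v‖ :=
        (norm_sub_le _ _).trans (add_le_add_right (ContinuousLinearMap.le_opNorm _ _) _)
    _ ≤ C₁ * (1 + H u) + C₃ * (C₂ * (1 + H u)) :=
        add_le_add (h₁ u v hv) (mul_le_mul (h₃ v hv) (h₂ u v hv) (norm_nonneg _) hC₃)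
    _ = (C₁ + C₃ * C₂) * (1 + H u) := by ring

section Production

variable {P : E → E}

lemma exists_inner_sub_le_mul_one_add (hs : CoerciveEntropy H g) (hP : Continuous P)
    (hgP : (fun u => (inner ℝ (g u) (P u) : ℝ)) =o[Bornology.cobounded E] H)
    (hPH : P =o[Bornology.cobounded E] H) (M : ℝ) :
    ∃ C, 0 ≤ C ∧ ∀ u v, ‖v‖ ≤ M → (inner ℝ (g u - g v) (P u - P v) : ℝ) ≤ C * (1 + H u) := by
  have hg := hs.contDiff_g.continuous
  obtain ⟨C₁, hC₁, h₁⟩ := hs.exists_norm_sub_le_mul_one_add (hg.inner (𝕜 := ℝ) hP) hgP M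
  obtain ⟨C₂, hC₂, h₂⟩ := hs.exists_norm_sub_le_mul_one_add hP hPH M
  obtain ⟨C₃, hC₃, h₃⟩ := hs.exists_norm_sub_le_mul_one_add hg hs.growth_g M
  obtain ⟨C₄, hC₄, h₄⟩ := exists_norm_le_on_ball hg M
  obtain ⟨C₅, hC₅, h₅⟩ := exists_norm_le_on_ball hP M
  refine ⟨C₁ + C₄ * C₂ + C₃ * C₅, by positivity, fun u v hv => ?_⟩
  have hgv : -(inner ℝ (g v) (P u - P v) : ℝ) ≤ C₄ * (C₂ * (1 + H u)) :=
    (neg_le_abs _).trans ((abs_real_inner_le_norm _ _).trans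
      (mul_le_mul (h₄ v hv) (h₂ u v hv) (norm_nonneg _) hC₄))
  have hPv : -(inner ℝ (g u - g v) (P v) : ℝ) ≤ C₃ * (1 + H u) * C₅ :=
    (neg_le_abs _).trans ((abs_real_inner_le_norm _ _).trans
      (mul_le_mul (h₃ u v hv) (h₅ v hv) (norm_nonneg _)
        (mul_nonneg hC₃ (add_nonneg zero_le_one (hs.nonneg u)))))
  calc (inner ℝ (g u - g v) (P u - P v) : ℝ)
      = (inner ℝ (g u) (P u) - inner ℝ (g v) (P v)) + -inner ℝ (g v) (P u - P v)
        + -inner ℝ (g u - g v) (P v) := by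
        simp only [inner_sub_left, inner_sub_right]
        ring
    _ ≤ C₁ * (1 + H u) + C₄ * (C₂ * (1 + H u)) + C₃ * (1 + H u) * C₅ :=
        add_le_add (add_le_add ((Real.le_norm_self _).trans (h₁ u v hv)) hgv) hPv
    _ = (C₁ + C₄ * C₂ + C₃ * C₅) * (1 + H u) := by ring

lemma relativelyDissipative_of_growth (hs : CoerciveEntropy H g) (hP : ContDiff ℝ 1 P)
    (hgP : (fun u => (inner ℝ (g u) (P u) : ℝ)) =o[Bornology.cobounded E] H)
    (hPH : P =o[Bornology.cobounded E] H) : RelativelyDissipative H g P := by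
  intro M
  refine hs.exists_le_mul_relEntropy (s := fun u v => inner ℝ (g u - g v) (P u - P v))
    (fun R => ?_) (hs.exists_inner_sub_le_mul_one_add hP.continuous hgP hPH M)
  obtain ⟨L₁, hL₁, h₁⟩ := exists_lipschitz_on_ball (hs.contDiff_g.of_le one_le_two) R
  obtain ⟨L₂, hL₂, h₂⟩ := exists_lipschitz_on_ball hP R
  refine ⟨L₁ * L₂, by positivity, fun u v hu hv => ?_⟩
  calc (inner ℝ (g u - g v) (P u - P v) : ℝ) ≤ ‖g u - g v‖ * ‖P u - P v‖ := real_inner_le_norm _ _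
    _ ≤ (L₁ * ‖u - v‖) * (L₂ * ‖u - v‖) :=
        mul_le_mul (h₁ u v hu hv) (h₂ u v hu hv) (norm_nonneg _) (by positivity)
    _ = L₁ * L₂ * ‖u - v‖ ^ 2 := by ring

lemma exists_production_le_relEntropy (hs : CoerciveEntropy H g) (hP : Continuous P)
    (hdiss : RelativelyDissipative H g P) (M : ℝ) :
    ∃ C, 0 ≤ C ∧ ∀ u v, ‖v‖ ≤ M →
      (inner ℝ (g u - g v) (P u) : ℝ) - inner ℝ (P v) (fderiv ℝ g v (u - v))
        ≤ C * relEntropy H g u v := by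
  obtain ⟨C₁, hC₁, h₁⟩ := hdiss M
  obtain ⟨C₂, hC₂, h₂⟩ := exists_norm_le_on_ball hP M
  obtain ⟨C₃, hC₃, h₃⟩ := hs.exists_norm_taylor_le_relEntropy hs.contDiff_g hs.growth_g M
  refine ⟨C₁ + C₂ * C₃, by positivity, fun u v hv => ?_⟩
  calc (inner ℝ (g u - g v) (P u) : ℝ) - inner ℝ (P v) (fderiv ℝ g v (u - v))
      = inner ℝ (g u - g v) (P u - P v)
        + inner ℝ (P v) (g u - g v - fderiv ℝ g v (u - v)) := by
        rw [inner_sub_right (g u - g v), inner_sub_right (P v), real_inner_comm (g u - g v) (P v)]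
        ring
    _ ≤ C₁ * relEntropy H g u v + C₂ * (C₃ * relEntropy H g u v) :=
        add_le_add (h₁ u v hv) ((real_inner_le_norm _ _).trans
          (mul_le_mul (h₂ v hv) (h₃ u v hv) (norm_nonneg _) hC₂))
    _ = (C₁ + C₂ * C₃) * relEntropy H g u v := by ring

end Production

end CoerciveEntropy

end RelativeEntropy

section ConservedStructure

/-- An entropy pair `(H, q)` for the fluxes `f α` in conserved variables: `g` is the gradient of
the coercive entropy `H`, and `H` dominates the fluxes at infinity. -/
structure ConservedStructure {ι E : Type*} [NormedAddCommGroup E] [InnerProductSpace ℝ E]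
    (f : ι → E → E) (H : E → ℝ) (q : ι → E → ℝ) (g : E → E) : Prop
    extends CoerciveEntropy H g where
  contDiff_f : ∀ α, ContDiff ℝ 2 (f α)
  grad_q : ∀ α v, HasFDerivAt (q α) ((innerSL ℝ (g v)).comp (fderiv ℝ (f α) v)) v
  growth_f : ∀ α, f α =o[Bornology.cobounded E] H

/-- The rate at which the dynamics changes `H(w | v)`, for a solution passing through `v` with time
derivative `τ` and spatial derivatives `σ α`; the terms in `τ` and `σ` come from transporting the
second argument. -/
noncomputable def relProduction {ι E : Type*} [Fintype ι] [NormedAddCommGroup E]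
    [InnerProductSpace ℝ E] (f : ι → E → E) (g P : E → E) (v τ : E) (σ : ι → E) (w : E) : ℝ :=
  inner ℝ (g w) (P w) - inner ℝ (g v) (P w) - inner ℝ (fderiv ℝ g v τ) (w - v)
    - ∑ α, inner ℝ (fderiv ℝ g v (σ α)) (f α w - f α v)

namespace ConservedStructure

variable {ι E : Type*} [NormedAddCommGroup E] [InnerProductSpace ℝ E]
  {f : ι → E → E} {H : E → ℝ} {q : ι → E → ℝ} {g P : E → E}

lemma hasFDerivAt_dual (hs : ConservedStructure f H q g) (v : E) :
    HasFDerivAt (fun v => (inner ℝ (g v) v : ℝ) - H v) ((innerSL ℝ v).comp (fderiv ℝ g v)) v := by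
  refine (((hs.differentiable_g v).hasFDerivAt.inner ℝ (hasFDerivAt_id v)).sub
    (hs.grad_H v)).congr_fderiv ?_
  ext ξ
  simp [fderivInnerCLM_apply, real_inner_comm]

lemma hasFDerivAt_dualFlux (hs : ConservedStructure f H q g) (α : ι) (v : E) :
    HasFDerivAt (fun v => (inner ℝ (g v) (f α v) : ℝ) - q α v)
      ((innerSL ℝ (f α v)).comp (fderiv ℝ g v)) v := by
  refine (((hs.differentiable_g v).hasFDerivAt.inner ℝ
    ((hs.contDiff_f α).differentiable two_ne_zero v).hasFDerivAt).sub
    (hs.grad_q α v)).congr_fderiv ?_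
  ext ξ
  simp [fderivInnerCLM_apply, real_inner_comm]

lemma contDiff_dual (hs : ConservedStructure f H q g) :
    ContDiff ℝ 1 (fun v => (inner ℝ (g v) v : ℝ) - H v) :=
  contDiff_one_iff_hasFDerivAt.2 ⟨_, (innerSL ℝ).continuous.clm_comp
    (hs.contDiff_g.continuous_fderiv two_ne_zero), hs.hasFDerivAt_dual⟩

lemma contDiff_dualFlux (hs : ConservedStructure f H q g) (α : ι) :
    ContDiff ℝ 1 (fun v => (inner ℝ (g v) (f α v) : ℝ) - q α v) :=
  contDiff_one_iff_hasFDerivAt.2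
    ⟨_, ((innerSL ℝ).continuous.comp (hs.contDiff_f α).continuous).clm_comp
      (hs.contDiff_g.continuous_fderiv two_ne_zero), hs.hasFDerivAt_dualFlux α⟩

variable [FiniteDimensional ℝ E]

lemma flux_symm (hs : ConservedStructure f H q g) (α : ι) (v ξ ζ : E) :
    (inner ℝ (fderiv ℝ g v ξ) (fderiv ℝ (f α) v ζ) : ℝ)
      = inner ℝ (fderiv ℝ g v ζ) (fderiv ℝ (f α) v ξ) := by
  have hf (ζ : E) : ContDiff ℝ 1 (fun v => fderiv ℝ (f α) v ζ) :=
    ((hs.contDiff_f α).fderiv_right (by norm_num)).clm_apply contDiff_const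
  have h := fderiv_gradient_symm (hs.grad_q α) (fun ζ => by
    simpa only [ContinuousLinearMap.comp_apply, innerSL_apply_apply] using
      (hs.contDiff_g.of_le one_le_two).inner ℝ (hf ζ)) v ξ ζ
  simp only [ContinuousLinearMap.comp_apply, innerSL_apply_apply] at h
  have hsymm : IsSymmSndFDerivAt ℝ (f α) v :=
    (hs.contDiff_f α).contDiffAt.isSymmSndFDerivAt (by simp)
  rw [fderiv_inner_apply ℝ (hs.differentiable_g v) ((hf ζ).differentiable one_ne_zero v),
    fderiv_inner_apply ℝ (hs.differentiable_g v) ((hf ξ).differentiable one_ne_zero v),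
    fderiv_fderiv_apply (hs.contDiff_f α), fderiv_fderiv_apply (hs.contDiff_f α),
    hsymm.eq ξ ζ] at h
  exact add_left_cancel h

variable [Fintype ι]

lemma relProduction_eq (hs : ConservedStructure f H q g) {v τ : E} {σ : ι → E}
    (heq : τ + ∑ α, fderiv ℝ (f α) v (σ α) = P v) (w : E) :
    relProduction f g P v τ σ w
      = inner ℝ (g w - g v) (P w) - inner ℝ (P v) (fderiv ℝ g v (w - v))
        - ∑ α, inner ℝ (fderiv ℝ g v (σ α)) (f α w - f α v - fderiv ℝ (f α) v (w - v)) := by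
  have htransport : (inner ℝ (fderiv ℝ g v τ) (w - v) : ℝ)
      = inner ℝ (P v) (fderiv ℝ g v (w - v))
        - ∑ α, inner ℝ (fderiv ℝ g v (σ α)) (fderiv ℝ (f α) v (w - v)) := by
    rw [hs.hessian_symm, eq_sub_of_add_eq heq, inner_sub_right, inner_sum, real_inner_comm]
    congr 1
    exact Finset.sum_congr rfl fun α _ => hs.flux_symm α v _ _
  simp only [relProduction, htransport, inner_sub_left, inner_sub_right _ (_ - _),
    Finset.sum_sub_distrib]
  ring

lemma exists_relProduction_le (hs : ConservedStructure f H q g) (hP : Continuous P)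
    (hdiss : RelativelyDissipative H g P) (M B : ℝ) :
    ∃ C, 0 ≤ C ∧ ∀ v τ σ, ‖v‖ ≤ M → (∀ α, ‖fderiv ℝ g v (σ α)‖ ≤ B) →
      τ + ∑ α, fderiv ℝ (f α) v (σ α) = P v →
      ∀ w, relProduction f g P v τ σ w ≤ C * relEntropy H g w v := by
  obtain ⟨C₁, hC₁, h₁⟩ := hs.exists_production_le_relEntropy hP hdiss M
  choose C₂ hC₂ h₂ using fun α =>
    hs.exists_norm_taylor_le_relEntropy (hs.contDiff_f α) (hs.growth_f α) M
  refine ⟨C₁ + ∑ α, |B| * C₂ α,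
    add_nonneg hC₁ (Finset.sum_nonneg fun α _ => mul_nonneg (abs_nonneg _) (hC₂ α)),
    fun v τ σ hv hσ heq w => ?_⟩
  have hflux (α : ι) : -(|B| * C₂ α * relEntropy H g w v)
      ≤ inner ℝ (fderiv ℝ g v (σ α)) (f α w - f α v - fderiv ℝ (f α) v (w - v)) := by
    refine neg_le_of_abs_le ((abs_real_inner_le_norm _ _).trans ?_)
    rw [mul_assoc]
    exact mul_le_mul ((hσ α).trans (le_abs_self B)) (h₂ α w v hv) (norm_nonneg _) (abs_nonneg _)
  have hsum := Finset.sum_le_sum fun α (_ : α ∈ Finset.univ) => hflux α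
  rw [Finset.sum_neg_distrib, ← Finset.sum_mul] at hsum
  rw [hs.relProduction_eq heq, add_mul]
  linarith [h₁ w v hv]

end ConservedStructure

end ConservedStructure

section ConservedVariables

variable {n d : ℕ} {A : State n → State n} {F : Fin d → State n → State n}
  {η : State n → ℝ} {q : Fin d → State n → ℝ} {G : State n → State n}

lemma GrowthConditions.tendsto_A_cobounded {p : ℝ} (hg : GrowthConditions p A F η) (hp : 0 < p) :
    Tendsto A (Bornology.cobounded (State n)) (Bornology.cobounded (State n)) := by
  obtain ⟨β₁, β₂, B, hβ₁, -, -, hη⟩ := hg.growth_η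
  obtain ⟨r, C, B', hr, hC, -, hA⟩ := hg.growth_H
  have hlower : Tendsto (fun u : State n => (β₁ * (‖u‖ ^ p + 1) - B) / C - 1)
      (Bornology.cobounded (State n)) atTop :=
    tendsto_atTop_add_const_right _ (-1) ((tendsto_atTop_add_const_right _ (-B)
      ((tendsto_atTop_add_const_right _ 1 ((tendsto_rpow_atTop hp).comp
        tendsto_norm_cobounded_atTop)).const_mul_atTop hβ₁)).atTop_div_const hC)
  have hpow : Tendsto (fun u => ‖A u‖ ^ r) (Bornology.cobounded (State n)) atTop := by
    refine tendsto_atTop_mono (fun u => ?_) hlower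
    rw [sub_le_iff_le_add, div_le_iff₀ hC]
    linarith [(hη u).1.trans (hA u).2]
  refine tendsto_norm_atTop_iff_cobounded.1 (tendsto_atTop.2 fun b => ?_)
  filter_upwards [hpow.eventually_gt_atTop (|b| ^ r)] with u hu
  exact (le_abs_self b).trans ((Real.rpow_lt_rpow_iff (abs_nonneg b) (norm_nonneg _)
    (by linarith)).1 hu).le

lemma EntropyStructure.exists_homeomorph (hs : EntropyStructure A F η q G)
    (hA : Tendsto A (Bornology.cobounded (State n)) (Bornology.cobounded (State n))) :
    ∃ e : State n ≃ₜ State n, ⇑e = A ∧ ContDiff ℝ 2 e.symm := by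
  set A' : State n → State n ≃L[ℝ] State n := fun u =>
    (fderiv ℝ A u).toContinuousLinearEquivOfDetNeZero (hs.nonsingular u)
  have hA' (u : State n) : HasStrictFDerivAt A (A' u : State n →L[ℝ] State n) u := by
    rw [ContinuousLinearMap.coe_toContinuousLinearEquivOfDetNeZero]
    exact hs.contDiff_A.contDiffAt.hasStrictFDerivAt two_ne_zero
  have hopen : IsOpenMap A := isOpenMap_of_hasStrictFDerivAt_equiv hA'
  have hproper : IsProperMap A := isProperMap_iff_tendsto_cocompact.2
    ⟨hs.contDiff_A.continuous, by simpa only [Metric.cobounded_eq_cocompact] using hA⟩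
  have hrange : IsClopen (range A) := ⟨hproper.isClosedMap.isClosed_range, hopen.isOpen_range⟩
  have hsurj : Function.Surjective A := range_eq_univ.1 (hrange.eq_univ (range_nonempty A))
  let e : State n ≃ₜ State n := (Equiv.ofBijective A ⟨hs.injective_A, hsurj⟩)
    |>.toHomeomorphOfContinuousOpen hs.contDiff_A.continuous hopen
  exact ⟨e, rfl, e.contDiff_symm (f₀' := A') (fun u => (hA' u).hasFDerivAt) hs.contDiff_A⟩

lemma EntropyStructure.inner_fderiv_G_pos (hs : EntropyStructure A F η q G) {u ξ : State n}
    (hξ : ξ ≠ 0) : 0 < (inner ℝ (fderiv ℝ G u ξ) (fderiv ℝ A u ξ) : ℝ) := by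
  have hA : DifferentiableAt ℝ (fun w => fderiv ℝ A w ξ) u :=
    ((hs.contDiff_A.fderiv_right (m := 1) (by norm_num)).clm_apply
      contDiff_const).differentiable one_ne_zero u
  have hhess := fderiv_fderiv_apply hs.contDiff_η u ξ ξ
  simp_rw [hs.grad_η] at hhess
  rw [fderiv_inner_apply ℝ (hs.contDiff_G.differentiable two_ne_zero u) hA,
    fderiv_fderiv_apply hs.contDiff_A] at hhess
  linarith [hs.pos_def u ξ hξ]

lemma fderiv_apply_fderiv_symm_apply {E F : Type*} [NormedAddCommGroup E] [NormedSpace ℝ E]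
    [NormedAddCommGroup F] [NormedSpace ℝ F] {e : E ≃ F} {v : F}
    (he : DifferentiableAt ℝ e (e.symm v)) (he' : DifferentiableAt ℝ e.symm v) (ξ : F) :
    fderiv ℝ e (e.symm v) (fderiv ℝ e.symm v ξ) = ξ := by
  have h := he.hasFDerivAt.comp v he'.hasFDerivAt
  rw [e.self_comp_symm] at h
  simpa using DFunLike.congr_fun (h.unique (hasFDerivAt_id v)) ξ

lemma tendsto_cobounded_of_homeomorph {X Y : Type*} [PseudoMetricSpace X] [ProperSpace X]
    [PseudoMetricSpace Y] [ProperSpace Y] (e : X ≃ₜ Y) :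
    Tendsto e (Bornology.cobounded X) (Bornology.cobounded Y) := by
  simpa only [Metric.cobounded_eq_cocompact, Tendsto] using e.map_cocompact.le

lemma EntropyStructure.conserved {e : State n ≃ₜ State n} (hs : EntropyStructure e F η q G)
    (he : ContDiff ℝ 2 e.symm) (hη : ∀ u, 0 ≤ η u)
    (hAη : e =o[Bornology.cobounded (State n)] η)
    (hFη : ∀ α, F α =o[Bornology.cobounded (State n)] η) (hG : GrowthG G η) :
    ConservedStructure (fun α => F α ∘ e.symm) (η ∘ e.symm) (fun α => q α ∘ e.symm)
      (G ∘ e.symm) := by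
  have hde (v : State n) : HasFDerivAt e.symm (fderiv ℝ e.symm v) v :=
    (he.differentiable two_ne_zero v).hasFDerivAt
  have hinv (v ξ : State n) : fderiv ℝ e (e.symm v) (fderiv ℝ e.symm v ξ) = ξ :=
    fderiv_apply_fderiv_symm_apply (e := e.toEquiv)
      (hs.contDiff_A.differentiable two_ne_zero _) (he.differentiable two_ne_zero v) ξ
  have htend := tendsto_cobounded_of_homeomorph e.symm
  refine
    { contDiff_f := fun α => (hs.contDiff_F α).comp he
      contDiff_g := hs.contDiff_G.comp he
      grad_H := fun v => ?grad_H
      grad_q := fun α v => ?grad_q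
      pos_def := fun v ξ hξ => ?pos_def
      nonneg := fun v => hη _
      growth_id := by simpa [Function.comp_def] using hAη.comp_tendsto htend
      growth_f := fun α => (hFη α).comp_tendsto htend
      growth_g := hG.comp_tendsto htend }
  case grad_H =>
    refine ((hs.contDiff_η.differentiable two_ne_zero _).hasFDerivAt.comp v
      (hde v)).congr_fderiv ?_
    ext ξ
    simp [hs.grad_η, hinv]
  case grad_q =>
    refine ((hs.differentiable_q α _).hasFDerivAt.comp v (hde v)).congr_fderiv ?_
    ext ξ
    rw [(((hs.contDiff_F α).differentiable two_ne_zero _).hasFDerivAt.comp v (hde v)).fderiv]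
    simp [hs.grad_q]
  case pos_def =>
    rw [((hs.contDiff_G.differentiable two_ne_zero _).hasFDerivAt.comp v (hde v)).fderiv]
    have hne : fderiv ℝ e.symm v ξ ≠ 0 := fun h0 => hξ (by rw [← hinv v ξ, h0, map_zero])
    simpa [hinv] using hs.inner_fderiv_G_pos (u := e.symm v) hne

lemma CoerciveEntropy.relativelyDissipative {H : State n → ℝ} {g P : State n → State n}
    (hs : CoerciveEntropy H g) (hP : ContDiff ℝ 1 P) (hGP : WeaklyDissipative g P ∨ GrowthP g P H) :
    RelativelyDissipative H g P := by
  rcases hGP with hweak | ⟨hgP, hPH⟩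
  · exact fun M => ⟨0, le_rfl, fun u v _ => by simpa using hweak u v⟩
  · exact hs.relativelyDissipative_of_growth hP hgP hPH

end ConservedVariables

section Averages

variable {E : Type*} [NormedAddCommGroup E] [InnerProductSpace ℝ E] [MeasurableSpace E]
  {H : E → ℝ} {g : E → E} {m : Measure E} [IsProbabilityMeasure m]

lemma integrable_relEntropy (v : E) (hid : Integrable (fun w => w) m) (hH : Integrable H m) :
    Integrable (fun w => relEntropy H g w v) m :=
  (hH.sub (integrable_const _)).sub ((hid.sub (integrable_const _)).const_inner _)

variable {ι : Type*} [Fintype ι] {f : ι → E → E} {P : E → E}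

lemma integrable_relProduction (v τ : E) (σ : ι → E) (hid : Integrable (fun w => w) m)
    (hf : ∀ α, Integrable (f α) m) (hP : Integrable P m)
    (hgP : Integrable (fun w => (inner ℝ (g w) (P w) : ℝ)) m) :
    Integrable (relProduction f g P v τ σ) m :=
  ((hgP.sub (hP.const_inner _)).sub ((hid.sub (integrable_const _)).const_inner _)).sub
    (integrable_finsetSum _ fun α _ => ((hf α).sub (integrable_const _)).const_inner _)

variable [CompleteSpace E]

lemma integral_relEntropy (v : E) (hid : Integrable (fun w => w) m) (hH : Integrable H m) :
    ∫ w, relEntropy H g w v ∂m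
      = (∫ w, H w ∂m) - inner ℝ (g v) (∫ w, w ∂m) + (inner ℝ (g v) v - H v) := by
  have hsub : Integrable (fun w => w - v) m := hid.sub (integrable_const v)
  have hsplit := integral_sub (hH.sub (integrable_const (H v))) (hsub.const_inner (𝕜 := ℝ) (g v))
  simp only [Pi.sub_apply] at hsplit
  simp only [relEntropy]
  rw [hsplit, integral_sub hH (integrable_const _), integral_inner hsub,
    integral_sub hid (integrable_const _)]
  simp only [integral_const, probReal_univ, one_smul, inner_sub_right]
  ring

lemma integral_relProduction (v τ : E) (σ : ι → E) (hid : Integrable (fun w => w) m)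
    (hf : ∀ α, Integrable (f α) m) (hP : Integrable P m)
    (hgP : Integrable (fun w => (inner ℝ (g w) (P w) : ℝ)) m) :
    ∫ w, relProduction f g P v τ σ w ∂m
      = (∫ w, inner ℝ (g w) (P w) ∂m) - inner ℝ (g v) (∫ w, P w ∂m)
        - inner ℝ (fderiv ℝ g v τ) ((∫ w, w ∂m) - v)
        - ∑ α, inner ℝ (fderiv ℝ g v (σ α)) ((∫ w, f α w ∂m) - f α v) := by
  have hid' : Integrable (fun w => w - v) m := hid.sub (integrable_const v)
  have hf' (α : ι) : Integrable (fun w => f α w - f α v) m := (hf α).sub (integrable_const _)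
  have hτ := hid'.const_inner (𝕜 := ℝ) (fderiv ℝ g v τ)
  have hσ (α : ι) := (hf' α).const_inner (𝕜 := ℝ) (fderiv ℝ g v (σ α))
  have hP' := hP.const_inner (𝕜 := ℝ) (g v)
  refine (integral_sub ((hgP.sub hP').sub hτ) (integrable_finsetSum _ fun α _ => hσ α)).trans ?_
  congr 1
  · refine (integral_sub (hgP.sub hP') hτ).trans (congrArg₂ _ ?_ ?_)
    · exact (integral_sub hgP hP').trans (by rw [integral_inner hP])
    · rw [integral_inner hid', integral_sub hid (integrable_const _), integral_const,
        probReal_univ, one_smul]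
  · rw [integral_finsetSum _ fun α _ => hσ α]
    refine Finset.sum_congr rfl fun α _ => ?_
    rw [integral_inner (hf' α), integral_sub (hf α) (integrable_const _), integral_const,
      probReal_univ, one_smul]

end Averages

section ClampedTest

section Basic

variable {d : ℕ} {E W : Type*} [NormedAddCommGroup W] [NormedSpace ℝ W] {T T₁ : ℝ}
  {hT : 0 ≤ T} {ξ : ℝ → ℝ} {h : E → W} {V : Torus d → ℝ → E}

/-- The test function `ξ h(V)`, with `ξ` frozen outside `[0, T]` to make it globally Lipschitz. -/
noncomputable def clampedTest (hT : 0 ≤ T) (ξ : ℝ → ℝ) (h : E → W) (V : Torus d → ℝ → E)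
    (x : Torus d) (t : ℝ) : W :=
  ξ (projIcc 0 T hT t) • h (V x t)

lemma clampedTest_of_mem {t : ℝ} (ht : t ∈ Icc 0 T) (x : Torus d) :
    clampedTest hT ξ h V x t = ξ t • h (V x t) := by
  rw [clampedTest, projIcc_of_mem hT ht]

lemma clampedTest_eq_zero (h0 : ∀ t ≥ T₁, ξ t = 0) (hT₁ : T₁ ≤ T) (x : Torus d) {t : ℝ}
    (ht : T₁ ≤ t) : clampedTest hT ξ h V x t = 0 := by
  rw [clampedTest, h0 _ (by simp [coe_projIcc, hT₁, ht]), zero_smul]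

end Basic

variable {d : ℕ} {E W : Type*} [NormedAddCommGroup E] [NormedSpace ℝ E]
  [NormedAddCommGroup W] [NormedSpace ℝ W]

lemma exists_lipschitzWith_comp [FiniteDimensional ℝ E] {X : Type*} [PseudoMetricSpace X]
    {h : E → W} (hh : ContDiff ℝ 1 h) {v : X → E} {K : ℝ≥0} (hv : LipschitzWith K v) {M : ℝ}
    (hM : ∀ x, ‖v x‖ ≤ M) : ∃ K' : ℝ≥0, LipschitzWith K' (fun x => h (v x)) := by
  obtain ⟨L, hL, hlip⟩ := exists_lipschitz_on_ball hh M
  refine ⟨L.toNNReal * K, LipschitzWith.of_dist_le_mul fun x y => ?_⟩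
  rw [dist_eq_norm, NNReal.coe_mul, Real.coe_toNNReal L hL, mul_assoc]
  refine (hlip _ _ (hM x) (hM y)).trans (mul_le_mul_of_nonneg_left ?_ hL)
  rw [← dist_eq_norm]
  exact hv.dist_le_mul x y

lemma pderiv_comp {h : E → W} {v : Torus d → E} {x : Torus d} {α : Fin d}
    (hh : DifferentiableAt ℝ h (v x))
    (hv : DifferentiableAt ℝ
      (fun s : ℝ => v (x + Pi.single α (s : AddCircle (2 * Real.pi)))) 0) :
    pderiv α (fun y => h (v y)) x = fderiv ℝ h (v x) (pderiv α v x) :=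
  (hh.hasFDerivAt.comp_hasDerivAt_of_eq (0 : ℝ) hv.hasDerivAt (by simp)).deriv

variable {T T₁ : ℝ} {hT : 0 ≤ T} {ξ : ℝ → ℝ} {h : E → W} {V : Torus d → ℝ → E}

lemma exists_lipschitzWith_clampedTest [FiniteDimensional ℝ E] (hξ : ContDiff ℝ 1 ξ)
    (hh : ContDiff ℝ 1 h) {K : ℝ≥0} (hV : LipschitzWith K (fun z : Torus d × ℝ => V z.1 z.2))
    {M : ℝ} (hM : ∀ x t, ‖V x t‖ ≤ M) :
    ∃ K' : ℝ≥0, LipschitzWith K' (fun z : Torus d × ℝ => clampedTest hT ξ h V z.1 z.2) := by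
  have hclamp : LipschitzWith (max 1 K)
      (fun z : Torus d × ℝ => ((projIcc 0 T hT z.2 : ℝ), V z.1 z.2)) := by
    refine LipschitzWith.prodMk ?_ hV
    simpa only [mul_one, Function.comp_def] using
      (LipschitzWith.subtype_val _).comp ((LipschitzWith.projIcc hT).comp LipschitzWith.prod_snd)
  refine exists_lipschitzWith_comp (h := fun p : ℝ × E => ξ p.1 • h p.2)
    ((hξ.comp contDiff_fst).smul (hh.comp contDiff_snd)) hclamp (M := max T M) fun z => ?_
  have hmem := (projIcc 0 T hT z.2).2
  exact max_le_max ((Real.norm_of_nonneg hmem.1).trans_le hmem.2) (hM z.1 z.2)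

lemma deriv_clampedTest (hξ : Differentiable ℝ ξ) (hh : Differentiable ℝ h) {x : Torus d} {t : ℝ}
    (ht : t ∈ Ioo 0 T) (hV : DifferentiableAt ℝ (V x) t) :
    deriv (clampedTest hT ξ h V x) t
      = ξ t • fderiv ℝ h (V x t) (deriv (V x) t) + deriv ξ t • h (V x t) := by
  have heq : clampedTest hT ξ h V x =ᶠ[𝓝 t] fun s => ξ s • h (V x s) := by
    filter_upwards [Icc_mem_nhds ht.1 ht.2] with s hs using clampedTest_of_mem hs x
  rw [heq.deriv_eq]
  exact ((hξ t).hasDerivAt.smul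
    ((hh (V x t)).hasFDerivAt.comp_hasDerivAt t hV.hasDerivAt)).deriv

lemma pderiv_clampedTest (hh : Differentiable ℝ h) {x : Torus d} {t : ℝ} (ht : t ∈ Icc 0 T)
    {α : Fin d} (hV : DifferentiableAt ℝ
      (fun s : ℝ => V (x + Pi.single α (s : AddCircle (2 * Real.pi))) t) 0) :
    pderiv α (fun y => clampedTest hT ξ h V y t) x
      = ξ t • fderiv ℝ h (V x t) (pderiv α (fun y => V y t) x) := by
  simp only [clampedTest_of_mem ht]
  rw [pderiv_comp (h := fun v => ξ t • h v) (v := fun y => V y t) ((hh _).const_smul _) hV,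
    fderiv_fun_const_smul (hh _)]
  rfl

end ClampedTest

section RelativeEntropyInequality

variable {n d : ℕ} {T : ℝ} {f : Fin d → State n → State n} {H : State n → ℝ}
  {q : Fin d → State n → ℝ} {g P : State n → State n} {μ : Kernel (Torus d × ℝ) (State n)}
  {γ : Measure (Torus d × ℝ)} {V : Torus d → ℝ → State n} {K : ℝ≥0} {M : ℝ}

lemma ae_restrict_cyl_of_forall_lt {p : Torus d × ℝ → Prop}
    (h : ∀ T' < T, ∀ᵐ z ∂(volume.restrict (cyl d T')), p z) :
    ∀ᵐ z ∂(volume.restrict (cyl d T)), p z := by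
  have hcyl (k : ℕ) : ∀ᵐ z, z ∈ cyl d (T - 1 / ((k : ℝ) + 1)) → p z :=
    (ae_restrict_iff' (measurableSet_cyl _)).1 (h _ (sub_lt_self _ (by positivity)))
  rw [ae_restrict_iff' (measurableSet_cyl T)]
  filter_upwards [ae_all_iff.2 hcyl] with z hz hzT
  obtain ⟨k, hk⟩ := exists_nat_one_div_lt (sub_pos.2 hzT.2.2)
  exact hz k ⟨mem_univ _, hzT.2.1, by linarith⟩

lemma ae_restrict_cyl_mem_Ioo :
    ∀ᵐ z ∂((volume : Measure (Torus d × ℝ)).restrict (cyl d T)), z.2 ∈ Ioo 0 T := by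
  have hne : ∀ᵐ z : Torus d × ℝ, z.2 ≠ 0 :=
    Measure.quasiMeasurePreserving_snd.ae (Measure.ae_ne volume 0)
  filter_upwards [ae_restrict_of_ae hne, ae_restrict_mem (measurableSet_cyl T)] with z hz hzT
  exact ⟨lt_of_le_of_ne hzT.2.1 hz.symm, hzT.2.2⟩

lemma exists_isCylWeight_of_continuous {w : ℝ → ℝ} {T' : ℝ} (hw : Continuous w)
    (h0 : ∀ t ≥ T', w t = 0) : ∃ C, IsCylWeight T' C fun z : Torus d × ℝ => w z.2 := by
  obtain ⟨C, hC⟩ := (isCompact_Icc (a := 0) (b := T')).exists_bound_of_continuousOn hw.continuousOn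
  exact ⟨C, (hw.comp continuous_snd).measurable, fun z hz => hC z.2 (Ico_subset_Icc_self hz.2),
    fun z => h0 z.2⟩

/-- The relative entropy `⟨μ_z, H(w | V(z))⟩` of a Young measure with respect to a field `V`. -/
noncomputable def avgRelEntropy (H : State n → ℝ) (g : State n → State n)
    (μ : Kernel (Torus d × ℝ) (State n)) (V : Torus d → ℝ → State n) : Torus d × ℝ → ℝ :=
  fun z => avg μ (fun w => relEntropy H g w (V z.1 z.2)) z

/-- The average under a Young measure of the rate of change `relProduction` along a field `V`. -/
noncomputable def avgRelProduction (f : Fin d → State n → State n) (g P : State n → State n)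
    (μ : Kernel (Torus d × ℝ) (State n)) (V : Torus d → ℝ → State n) : Torus d × ℝ → ℝ :=
  fun z => avg μ (relProduction f g P (V z.1 z.2) (deriv (V z.1) z.2)
    fun α => pderiv α (fun y => V y z.2) z.1) z

/-- Dissipative measure-valued solutions of `∂_t w + ∂_α f_α(w) = P(w)` in conserved variables,
with entropy `H` and `g = ∇H`, whose initial datum is the Dirac family at `v₀`. -/
structure IsConservedMVSolution (T : ℝ) (f : Fin d → State n → State n) (P : State n → State n)
    (H : State n → ℝ) (g : State n → State n) (μ : Kernel (Torus d × ℝ) (State n))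
    (γ : Measure (Torus d × ℝ)) (v₀ : Torus d → State n) : Prop where
  markov : IsMarkovKernel μ
  integrable_id : ∀ T' < T, AvgIntegrable (volume.restrict (cyl d T')) μ (fun w => w)
  integrable_f : ∀ T' < T, ∀ α, AvgIntegrable (volume.restrict (cyl d T')) μ (f α)
  integrable_P : ∀ T' < T, AvgIntegrable (volume.restrict (cyl d T')) μ P
  integrable_H : ∀ T' < T, AvgIntegrable (volume.restrict (cyl d T')) μ H
  integrable_gP : ∀ T' < T,
    AvgIntegrable (volume.restrict (cyl d T')) μ (fun w => (inner ℝ (g w) (P w) : ℝ))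
  balance : IsWeakBalance T (avg μ (fun w => w)) (fun α => avg μ (f α)) (avg μ P) v₀
  entropy : ∀ ξ : ℝ → ℝ, IsTimeTest T ξ →
    0 ≤ (∫ z in cyl d T, deriv ξ z.2 * avg μ H z) + (∫ z in cyl d T, deriv ξ z.2 ∂γ)
      + ξ 0 * (∫ x, H (v₀ x))
      + ∫ z in cyl d T, ξ z.2 * avg μ (fun w => (inner ℝ (g w) (P w) : ℝ)) z

/-- Bounded, globally Lipschitz fields `V` which solve `∂_t V + ∂_α f_α(V) = P(V)` almost
everywhere on `𝕋ᵈ × [0, T)`. -/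
structure IsLipschitzSolution (T : ℝ) (f : Fin d → State n → State n) (P : State n → State n)
    (V : Torus d → ℝ → State n) : Prop where
  lipschitz : ∃ K : ℝ≥0, LipschitzWith K (fun z : Torus d × ℝ => V z.1 z.2)
  bounded : ∃ M, ∀ x t, ‖V x t‖ ≤ M
  equation : ∀ᵐ z ∂(volume.restrict (cyl d T)),
    deriv (V z.1) z.2 + ∑ α, pderiv α (fun y => f α (V y z.2)) z.1 = P (V z.1 z.2)

lemma integral_clampedTest_initial {hT : 0 ≤ T} {ξ : ℝ → ℝ} (hξT : ξ T = 0) (hg : Continuous g)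
    (hH : Continuous H) (hV : Continuous fun x => V x 0) :
    (∫ x, (inner ℝ (clampedTest hT ξ g V x 0) (V x 0) : ℝ))
        + ∫ x, (clampedTest hT ξ (fun v => (inner ℝ (g v) v : ℝ) - H v) V x T
          - clampedTest hT ξ (fun v => (inner ℝ (g v) v : ℝ) - H v) V x 0)
      = ξ 0 * ∫ x, H (V x 0) := by
  have hint {h : Torus d → ℝ} (hh : Continuous h) : Integrable h :=
    hh.integrable_of_hasCompactSupport (.of_compactSpace _)
  have hinner := hint ((hg.comp hV).inner hV)
  have hentropy := hint (hH.comp hV)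
  have hsub := integral_sub hinner hentropy
  simp only [Function.comp_apply] at hsub
  simp only [clampedTest_of_mem (left_mem_Icc.2 hT), clampedTest_of_mem (right_mem_Icc.2 hT), hξT,
    zero_mul, zero_sub, real_inner_smul_left, smul_eq_mul, integral_neg, integral_const_mul, hsub]
  ring

namespace IsConservedMVSolution

lemma integrable_avgRelEntropy {v₀ : Torus d → State n}
    (hsol : IsConservedMVSolution T f P H g μ γ v₀) (hg : Continuous g) (hH : Continuous H)
    (hV : Continuous fun z : Torus d × ℝ => V z.1 z.2) (hM : ∀ x t, ‖V x t‖ ≤ M)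
    {T' : ℝ} (hT' : T' < T) :
    Integrable (avgRelEntropy H g μ V) (volume.restrict (cyl d T')) := by
  have := hsol.markov
  have hid := hsol.integrable_id T' hT'
  have hintH := hsol.integrable_H T' hT'
  obtain ⟨C, -, hgC⟩ := exists_norm_le_on_ball hg M
  obtain ⟨C', -, hdual⟩ := exists_norm_le_on_ball (h := fun v => (inner ℝ (g v) v : ℝ) - H v)
    ((hg.inner continuous_id).sub hH) M
  have hinner : Integrable (fun z : Torus d × ℝ =>
      (inner ℝ (g (V z.1 z.2)) (avg μ (fun w => w) z) : ℝ)) (volume.restrict (cyl d T')) := by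
    refine (hid.2.norm.const_mul C).mono'
      ((hg.comp hV).aestronglyMeasurable.inner hid.2.aestronglyMeasurable) (.of_forall fun z => ?_)
    exact (norm_inner_le_norm _ _).trans
      (mul_le_mul_of_nonneg_right (hgC _ (hM _ _)) (norm_nonneg _))
  have hconst : Integrable (fun z : Torus d × ℝ =>
      (inner ℝ (g (V z.1 z.2)) (V z.1 z.2) : ℝ) - H (V z.1 z.2)) (volume.restrict (cyl d T')) :=
    .of_bound (((hg.comp hV).inner hV).sub (hH.comp hV)).aestronglyMeasurable C'
      (.of_forall fun z => hdual _ (hM _ _))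
  refine ((hintH.2.sub hinner).add hconst).congr ?_
  filter_upwards [hid.1, hintH.1] with z hzid hzH
  exact (integral_relEntropy (V z.1 z.2) hzid hzH).symm

lemma ae_weighted_relEntropy_eq {v₀ : Torus d → State n}
    (hsol : IsConservedMVSolution T f P H g μ γ v₀) (hs : ConservedStructure f H q g)
    (hV : LipschitzWith K (fun z : Torus d × ℝ => V z.1 z.2)) {ξ : ℝ → ℝ}
    (hξ : Differentiable ℝ ξ) (hT : 0 ≤ T) :
    ∀ᵐ z ∂(volume.restrict (cyl d T)),
      deriv ξ z.2 * avgRelEntropy H g μ V z + ξ z.2 * avgRelProduction f g P μ V z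
        = deriv ξ z.2 * avg μ H z + ξ z.2 * avg μ (fun w => (inner ℝ (g w) (P w) : ℝ)) z
          - weakPairing (avg μ fun w => w) (fun α => avg μ (f α)) (avg μ P)
            (clampedTest hT ξ g V) z
          + deriv (clampedTest hT ξ (fun v => (inner ℝ (g v) v : ℝ) - H v) V z.1) z.2
          + ∑ α, pderiv α (fun y => clampedTest hT ξ
            (fun v => (inner ℝ (g v) (f α v) : ℝ) - q α v) V y z.2) z.1 := by
  have := hsol.markov
  filter_upwards [ae_restrict_cyl_mem_Ioo, ae_restrict_of_ae (ae_differentiableAt_lines hV),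
    ae_restrict_cyl_of_forall_lt fun T' h => (hsol.integrable_id T' h).1,
    ae_restrict_cyl_of_forall_lt fun T' h => ae_all_iff.2 fun α => (hsol.integrable_f T' h α).1,
    ae_restrict_cyl_of_forall_lt fun T' h => (hsol.integrable_P T' h).1,
    ae_restrict_cyl_of_forall_lt fun T' h => (hsol.integrable_H T' h).1,
    ae_restrict_cyl_of_forall_lt fun T' h => (hsol.integrable_gP T' h).1]
    with z hzT hdiff hid hf hP hH hgP
  have hdg := hs.differentiable_g
  have hIcc := Ioo_subset_Icc_self hzT
  have hdual := hs.contDiff_dual.differentiable one_ne_zero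
  have hflux (α : Fin d) := (hs.contDiff_dualFlux α).differentiable one_ne_zero
  simp only [weakPairing, deriv_clampedTest hξ hdg hzT hdiff.1,
    deriv_clampedTest hξ hdual hzT hdiff.1, pderiv_clampedTest hdg hIcc (hdiff.2 _),
    fun α => pderiv_clampedTest (hT := hT) (ξ := ξ) (hflux α) hIcc (hdiff.2 α),
    (hs.hasFDerivAt_dual _).fderiv, (hs.hasFDerivAt_dualFlux _ _).fderiv]
  simp only [clampedTest_of_mem hIcc, avgRelEntropy, avgRelProduction]
  rw [avg, integral_relEntropy _ hid hH, avg, integral_relProduction _ _ _ hid hf hP hgP]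
  simp only [avg, ContinuousLinearMap.comp_apply, innerSL_apply_apply, inner_add_left,
    real_inner_smul_left, smul_eq_mul, inner_sub_right, Finset.sum_sub_distrib, mul_sub, mul_add,
    ← Finset.mul_sum, real_inner_comm]
  ring

lemma integral_weighted_relEntropy (hsol : IsConservedMVSolution T f P H g μ γ fun x => V x 0)
    (hs : ConservedStructure f H q g) (hV : LipschitzWith K (fun z : Torus d × ℝ => V z.1 z.2))
    (hM : ∀ x t, ‖V x t‖ ≤ M) {ξ : ℝ → ℝ} (hξ : IsTimeTest T ξ) (hT : 0 ≤ T) :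
    Integrable (fun z => deriv ξ z.2 * avgRelEntropy H g μ V z
        + ξ z.2 * avgRelProduction f g P μ V z) (volume.restrict (cyl d T)) ∧
      ∫ z in cyl d T, (deriv ξ z.2 * avgRelEntropy H g μ V z
          + ξ z.2 * avgRelProduction f g P μ V z)
        = (∫ z in cyl d T, deriv ξ z.2 * avg μ H z) + ξ 0 * (∫ x, H (V x 0))
          + ∫ z in cyl d T, ξ z.2 * avg μ (fun w => (inner ℝ (g w) (P w) : ℝ)) z := by
  obtain ⟨T₁, hT₁, h0⟩ := hξ.support
  obtain ⟨T', hT₁', hT'⟩ := exists_between hT₁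
  have hg : ContDiff ℝ 1 g := hs.contDiff_g.of_le one_le_two
  obtain ⟨KΓ, hΓ⟩ := exists_lipschitzWith_clampedTest (hT := hT) hξ.contDiff hg hV hM
  obtain ⟨KΨ, hΨ⟩ := exists_lipschitzWith_clampedTest (hT := hT) hξ.contDiff hs.contDiff_dual hV hM
  choose KX hX using fun α => exists_lipschitzWith_clampedTest (hT := hT) hξ.contDiff
    (hs.contDiff_dualFlux α) hV hM
  obtain ⟨C, hC⟩ := exists_isCylWeight_of_continuous (d := d) hξ.contDiff.continuous
    fun t ht => h0 t (hT₁'.le.trans ht)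
  obtain ⟨C', hC'⟩ := exists_isCylWeight_of_continuous (d := d)
    (hξ.contDiff.continuous_deriv_one) fun t ht => deriv_eq_zero_of_eq_zero_of_le h0
      (hT₁'.trans_le ht)
  obtain ⟨hpair, hpair_eq⟩ := hsol.balance.lipschitz_test_inner hΓ hT₁
    fun x t ht => clampedTest_eq_zero h0 hT₁.le x ht
  have hHint := hC'.integrable_smul (T := T) (hsol.integrable_H T' hT').2
  have hPint := hC.integrable_smul (T := T) (hsol.integrable_gP T' hT').2
  have hΨint := integrable_cyl_deriv hΨ T
  have hXint := integrable_finsetSum Finset.univ fun α _ => integrable_cyl_pderiv (hX α) T α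
  have hae := hsol.ae_weighted_relEntropy_eq hs hV (hξ.contDiff.differentiable one_ne_zero) hT
  refine ⟨((((hHint.add hPint).sub hpair).add hΨint).add hXint).congr
    (hae.mono fun z hz => hz.symm), (integral_congr_ae hae).trans ?_⟩
  refine (integral_add' (((hHint.add hPint).sub hpair).add hΨint) hXint).trans ?_
  rw [integral_add' ((hHint.add hPint).sub hpair) hΨint, integral_sub' (hHint.add hPint) hpair,
    integral_add' hHint hPint, integral_finsetSum _ fun α _ => integrable_cyl_pderiv (hX α) T α]
  simp only [fun α => integral_cyl_pderiv (hX α) T α, Finset.sum_const_zero, smul_eq_mul]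
  have hinitial := integral_clampedTest_initial (hT := hT) (V := V) (h0 T hT₁.le)
    hg.continuous hs.contDiff_H.continuous (lipschitzWith_space hV 0).continuous
  linarith [integral_cyl_deriv hΨ hT]

lemma exists_avgRelProduction_le {v₀ : Torus d → State n}
    (hsol : IsConservedMVSolution T f P H g μ γ v₀) (hs : ConservedStructure f H q g)
    (hP : Continuous P) (hdiss : RelativelyDissipative H g P) (hV : IsLipschitzSolution T f P V) :
    ∃ C, 0 ≤ C ∧ ∀ᵐ z ∂(volume.restrict (cyl d T)),
      avgRelProduction f g P μ V z ≤ C * avgRelEntropy H g μ V z := by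
  have := hsol.markov
  obtain ⟨K, hK⟩ := hV.lipschitz
  obtain ⟨M, hM⟩ := hV.bounded
  obtain ⟨B, hB⟩ := exists_lipschitzWith_comp (hs.contDiff_g.of_le one_le_two) hK
    fun z => hM z.1 z.2
  obtain ⟨C, hC, hle⟩ := hs.exists_relProduction_le hP hdiss M B
  refine ⟨C, hC, ?_⟩
  filter_upwards [hV.equation, ae_restrict_of_ae (ae_differentiableAt_lines hK),
    ae_restrict_cyl_of_forall_lt fun T' h => (hsol.integrable_id T' h).1,
    ae_restrict_cyl_of_forall_lt fun T' h => ae_all_iff.2 fun α => (hsol.integrable_f T' h α).1,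
    ae_restrict_cyl_of_forall_lt fun T' h => (hsol.integrable_P T' h).1,
    ae_restrict_cyl_of_forall_lt fun T' h => (hsol.integrable_H T' h).1,
    ae_restrict_cyl_of_forall_lt fun T' h => (hsol.integrable_gP T' h).1]
    with z heq hdiff hid hf hP hH hgP
  have hchain {h : State n → State n} (hh : Differentiable ℝ h) (α : Fin d) :=
    pderiv_comp (v := fun y => V y z.2) (hh (V z.1 z.2)) (hdiff.2 α)
  have hgrad (α : Fin d) :
      ‖fderiv ℝ g (V z.1 z.2) (pderiv α (fun y => V y z.2) z.1)‖ ≤ B := by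
    rw [← hchain hs.differentiable_g α]
    exact norm_pderiv_le (lipschitzWith_space (f := fun x t => g (V x t)) hB z.2) α z.1
  simp only [fun α => hchain ((hs.contDiff_f α).differentiable two_ne_zero) α] at heq
  exact (integral_mono (integrable_relProduction _ _ _ hid hf hP hgP)
    ((integrable_relEntropy _ hid hH).const_mul C)
    fun w => hle _ _ _ (hM z.1 z.2) hgrad heq w).trans_eq (integral_const_mul _ _)

theorem exists_relEntropy_inequality (hsol : IsConservedMVSolution T f P H g μ γ fun x => V x 0)
    (hs : ConservedStructure f H q g) (hP : Continuous P) (hdiss : RelativelyDissipative H g P)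
    (hV : IsLipschitzSolution T f P V) (hT : 0 ≤ T) :
    ∃ C, 0 ≤ C ∧ ∀ ξ : ℝ → ℝ, IsTimeTest T ξ →
      0 ≤ (∫ z in cyl d T, (deriv ξ z.2 + C * ξ z.2) * avgRelEntropy H g μ V z)
        + ∫ z in cyl d T, deriv ξ z.2 ∂γ := by
  obtain ⟨K, hK⟩ := hV.lipschitz
  obtain ⟨M, hM⟩ := hV.bounded
  obtain ⟨C, hC, hle⟩ := hsol.exists_avgRelProduction_le hs hP hdiss hV
  refine ⟨C, hC, fun ξ hξ => ?_⟩
  obtain ⟨hint, heq⟩ := hsol.integral_weighted_relEntropy hs hK hM hξ hT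
  obtain ⟨T₁, hT₁, h0⟩ := hξ.support
  obtain ⟨T', hT₁', hT'⟩ := exists_between hT₁
  obtain ⟨B, hB⟩ := exists_isCylWeight_of_continuous (d := d) (T' := T')
    (w := fun t => deriv ξ t + C * ξ t)
    (hξ.contDiff.continuous_deriv_one.add (hξ.contDiff.continuous.const_mul C)) fun t ht => by
      rw [deriv_eq_zero_of_eq_zero_of_le h0 (hT₁'.trans_le ht), h0 t (hT₁'.le.trans ht), mul_zero,
        add_zero]
  have hint' := hB.integrable_smul (T := T) (hsol.integrable_avgRelEntropy
    hs.contDiff_g.continuous hs.contDiff_H.continuous hK.continuous hM hT')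
  have hmono := integral_mono_ae hint hint' <| by
    filter_upwards [hle, ae_restrict_mem (measurableSet_cyl T)] with z hz hzT
    rw [smul_eq_mul, add_mul, mul_comm C, mul_assoc]
    gcongr
    exact hξ.nonneg _ hzT.2.1
  simp only [smul_eq_mul] at hmono
  linarith [hsol.entropy ξ hξ]

end IsConservedMVSolution

end RelativeEntropyInequality

section Gronwall

variable {d : ℕ} {T : ℝ}

lemma hasDerivAt_max_zero_sq (s : ℝ) : HasDerivAt (fun s : ℝ => max s 0 ^ 2) (2 * max s 0) s := by
  refine hasDerivAt_of_hasDerivAt_of_ne' (x := 0) (g := fun s => 2 * max s 0) (fun s hs => ?_)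
    (by fun_prop) (by fun_prop) s
  rcases lt_or_gt_of_ne hs with hneg | hpos
  · have heq : (fun s : ℝ => max s 0 ^ 2) =ᶠ[𝓝 s] fun _ => 0 := by
      filter_upwards [gt_mem_nhds hneg] with r hr
      simp [max_eq_right hr.le]
    simpa [max_eq_right hneg.le] using (hasDerivAt_const s (0 : ℝ)).congr_of_eventuallyEq heq
  · have heq : (fun s : ℝ => max s 0 ^ 2) =ᶠ[𝓝 s] fun s => s ^ 2 := by
      filter_upwards [lt_mem_nhds hpos] with r hr
      simp [max_eq_left hr.le]
    simpa [max_eq_left hpos.le] using (hasDerivAt_pow 2 s).congr_of_eventuallyEq heq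

/-- The Gronwall weight `e^{-Ct} ((T' - t)⁺)²`; the square makes it `C¹` across `t = T'`. -/
noncomputable def timeWeight (C T' t : ℝ) : ℝ := Real.exp (-(C * t)) * max (T' - t) 0 ^ 2

lemma timeWeight_nonneg (C T' t : ℝ) : 0 ≤ timeWeight C T' t := by
  unfold timeWeight
  positivity

lemma hasDerivAt_timeWeight (C T' t : ℝ) :
    HasDerivAt (timeWeight C T')
      (-(C * timeWeight C T' t) - 2 * Real.exp (-(C * t)) * max (T' - t) 0) t := by
  have hexp : HasDerivAt (fun t : ℝ => Real.exp (-(C * t))) (Real.exp (-(C * t)) * -(C * 1)) t :=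
    ((hasDerivAt_id t).const_mul C).neg.exp
  have hsq : HasDerivAt (fun t : ℝ => max (T' - t) 0 ^ 2) (2 * max (T' - t) 0 * -1) t :=
    (hasDerivAt_max_zero_sq (T' - t)).comp t ((hasDerivAt_id t).const_sub T')
  refine (hexp.mul hsq).congr_deriv ?_
  simp only [timeWeight]
  ring

lemma isTimeTest_timeWeight (C : ℝ) {T' : ℝ} (hT : T' < T) : IsTimeTest T (timeWeight C T') where
  contDiff := by
    rw [contDiff_one_iff_deriv, funext fun t => (hasDerivAt_timeWeight C T' t).deriv]
    refine ⟨fun t => (hasDerivAt_timeWeight C T' t).differentiableAt, ?_⟩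
    unfold timeWeight
    fun_prop
  support := ⟨T', hT, fun t ht => by simp [timeWeight, max_eq_right (sub_nonpos.2 ht)]⟩
  nonneg t _ := timeWeight_nonneg C T' t

theorem ae_eq_zero_of_weak_inequality {R : Torus d × ℝ → ℝ} {γ : Measure (Torus d × ℝ)} {C : ℝ}
    (hC : 0 ≤ C) (hR : ∀ T' < T, Integrable R (volume.restrict (cyl d T')))
    (hR0 : ∀ z, 0 ≤ R z)
    (hineq : ∀ ξ : ℝ → ℝ, IsTimeTest T ξ →
      0 ≤ (∫ z in cyl d T, (deriv ξ z.2 + C * ξ z.2) * R z) + ∫ z in cyl d T, deriv ξ z.2 ∂γ) :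
    ∀ᵐ z ∂(volume.restrict (cyl d T)), R z = 0 := by
  refine ae_restrict_cyl_of_forall_lt fun T' hT => ?_
  set w : ℝ → ℝ := fun t => 2 * Real.exp (-(C * t)) * max (T' - t) 0 with hw
  have hw0 (t : ℝ) : 0 ≤ w t := by positivity
  have hderiv (t : ℝ) : deriv (timeWeight C T') t = -(C * timeWeight C T' t) - w t :=
    (hasDerivAt_timeWeight C T' t).deriv
  have hγ : ∫ z in cyl d T, deriv (timeWeight C T') z.2 ∂γ ≤ 0 := by
    refine integral_nonpos fun z => ?_
    rw [hderiv, Pi.zero_apply]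
    linarith [mul_nonneg hC (timeWeight_nonneg C T' z.2), hw0 z.2]
  have hint : ∫ z in cyl d T, w z.2 * R z ≤ 0 := by
    have hweight (z : Torus d × ℝ) :
        (deriv (timeWeight C T') z.2 + C * timeWeight C T' z.2) * R z = -(w z.2 * R z) := by
      rw [hderiv]
      ring
    have h := hineq _ (isTimeTest_timeWeight C hT)
    simp only [hweight, integral_neg] at h
    linarith
  obtain ⟨B, hB⟩ := exists_isCylWeight_of_continuous (d := d) (w := w) (T' := T')
    (by fun_prop) fun t ht => by simp [hw, max_eq_right (sub_nonpos.2 ht)]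
  have hnonneg (z : Torus d × ℝ) : 0 ≤ w z.2 * R z := mul_nonneg (hw0 z.2) (hR0 z)
  have hzero := (integral_eq_zero_iff_of_nonneg hnonneg
    (hB.integrable_smul (T := T) (hR T' hT))).1 (le_antisymm hint (integral_nonneg hnonneg))
  filter_upwards [ae_restrict_of_ae_restrict_of_subset (cyl_subset_cyl hT.le) hzero,
    ae_restrict_mem (measurableSet_cyl T')] with z hz hzT
  have hpos : 0 < max (T' - z.2) 0 := lt_max_of_lt_left (sub_pos.2 hzT.2.2)
  exact (mul_eq_zero.1 hz).resolve_left (by positivity)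

end Gronwall

section Uniqueness

lemma eq_dirac_of_ae_eq {E : Type*} [MeasurableSpace E] {m : Measure E} [IsProbabilityMeasure m]
    {v : E} (h : ∀ᵐ w ∂m, w = v) : m = Measure.dirac v := by
  calc m = m.map fun w => w := Measure.map_id'.symm
    _ = m.map fun _ => v := Measure.map_congr h
    _ = Measure.dirac v := by rw [Measure.map_const, measure_univ, one_smul]

lemma CoerciveEntropy.eq_dirac_of_integral_relEntropy_eq_zero {E : Type*} [NormedAddCommGroup E]
    [InnerProductSpace ℝ E] [FiniteDimensional ℝ E] [MeasurableSpace E] {H : E → ℝ} {g : E → E}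
    (hs : CoerciveEntropy H g) {m : Measure E} [IsProbabilityMeasure m] {v : E}
    (hid : Integrable (fun w => w) m) (hH : Integrable H m)
    (h0 : ∫ w, relEntropy H g w v ∂m = 0) : m = Measure.dirac v := by
  refine eq_dirac_of_ae_eq ?_
  filter_upwards [(integral_eq_zero_iff_of_nonneg (fun w => hs.relEntropy_nonneg w v)
    (integrable_relEntropy v hid hH)).1 h0] with w hw using hs.eq_of_relEntropy_eq_zero hw

variable {n d : ℕ} {T : ℝ} {f : Fin d → State n → State n} {H : State n → ℝ}
  {q : Fin d → State n → ℝ} {g P : State n → State n} {μ : Kernel (Torus d × ℝ) (State n)}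
  {γ : Measure (Torus d × ℝ)} {V : Torus d → ℝ → State n}

theorem IsConservedMVSolution.ae_eq_dirac
    (hsol : IsConservedMVSolution T f P H g μ γ fun x => V x 0) (hs : ConservedStructure f H q g)
    (hP : Continuous P) (hdiss : RelativelyDissipative H g P) (hV : IsLipschitzSolution T f P V)
    (hT : 0 ≤ T) : ∀ᵐ z ∂(volume.restrict (cyl d T)), μ z = Measure.dirac (V z.1 z.2) := by
  have := hsol.markov
  obtain ⟨K, hK⟩ := hV.lipschitz
  obtain ⟨M, hM⟩ := hV.bounded
  obtain ⟨C, hC, hineq⟩ := hsol.exists_relEntropy_inequality hs hP hdiss hV hT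
  have hzero := ae_eq_zero_of_weak_inequality hC
    (fun T' => hsol.integrable_avgRelEntropy hs.contDiff_g.continuous hs.contDiff_H.continuous
      hK.continuous hM)
    (fun z => integral_nonneg fun w => hs.relEntropy_nonneg w (V z.1 z.2)) hineq
  filter_upwards [hzero, ae_restrict_cyl_of_forall_lt fun T' h => (hsol.integrable_id T' h).1,
    ae_restrict_cyl_of_forall_lt fun T' h => (hsol.integrable_H T' h).1] with z h0 hid hH
  exact hs.eq_dirac_of_integral_relEntropy_eq_zero hid hH h0

end Uniqueness

section Transfer

lemma avg_map_homeomorph {X W : Type*} [MeasurableSpace X] {n : ℕ} [NormedAddCommGroup W]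
    [NormedSpace ℝ W] (ν : Kernel X (State n)) (e : State n ≃ₜ State n) (f : State n → W) :
    avg (ν.map e) f = avg ν (f ∘ e) := by
  ext z
  rw [avg, Kernel.map_apply _ e.continuous.measurable]
  exact e.measurableEmbedding.integral_map f

lemma avgIntegrable_map_homeomorph {X W : Type*} [MeasurableSpace X] {n : ℕ}
    [NormedAddCommGroup W] [NormedSpace ℝ W] {m : Measure X} {ν : Kernel X (State n)}
    {e : State n ≃ₜ State n} {f : State n → W} :
    AvgIntegrable m (ν.map e) f ↔ AvgIntegrable m ν (f ∘ e) := by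
  simp only [AvgIntegrable, avg_map_homeomorph, Kernel.map_apply _ e.continuous.measurable,
    e.measurableEmbedding.integrable_map_iff]

variable {n d : ℕ} {T p : ℝ} {e : State n ≃ₜ State n} {F : Fin d → State n → State n}
  {P : State n → State n} {η : State n → ℝ} {G : State n → State n} {u ubar : Torus d → ℝ → State n}
  {ν : Kernel (Torus d × ℝ) (State n)} {γ : Measure (Torus d × ℝ)} {ν₀ : Kernel (Torus d) (State n)}
  {v₀ : Torus d → State n}

lemma avg_ae_eq_of_ae_eq_dirac {X W : Type*} [MeasurableSpace X] [NormedAddCommGroup W]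
    [NormedSpace ℝ W] [CompleteSpace W] {m : Measure X} {ν : Kernel X (State n)} {v : X → State n}
    (h : ∀ᵐ x ∂m, ν x = Measure.dirac (v x)) (f : State n → W) :
    avg ν f =ᵐ[m] fun x => f (v x) := by
  filter_upwards [h] with x hx
  rw [avg, hx, integral_dirac]

lemma IsDissipativeMVSolution.isConservedMVSolution
    (hmv : IsDissipativeMVSolution T p e F P η G u ν γ ν₀ 0)
    (hν₀ : ∀ᵐ x, ν₀ x = Measure.dirac (e.symm (v₀ x))) :
    IsConservedMVSolution T (fun α => F α ∘ e.symm) (P ∘ e.symm) (η ∘ e.symm) (G ∘ e.symm)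
      (ν.map e) γ v₀ := by
  have := hmv.markov
  have havg {W : Type} [NormedAddCommGroup W] [NormedSpace ℝ W] (f : State n → W) :
      avg (ν.map e) (fun w => f (e.symm w)) = avg ν f := by
    simp [avg_map_homeomorph, Function.comp_def]
  have havg_id : avg (ν.map e) (fun w => w) = avg ν e := avg_map_homeomorph ν e _
  have hint {W : Type} [NormedAddCommGroup W] [NormedSpace ℝ W] {f : State n → W}
      {m : Measure (Torus d × ℝ)} (h : AvgIntegrable m ν f) :
      AvgIntegrable m (ν.map e) (fun w => f (e.symm w)) :=
    avgIntegrable_map_homeomorph.2 (by simpa [Function.comp_def] using h)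
  have hA₀ : avg ν₀ e =ᵐ[volume] v₀ := by simpa using avg_ae_eq_of_ae_eq_dirac hν₀ e
  refine
    { markov := Kernel.IsMarkovKernel.map ν e.continuous.measurable
      integrable_id := fun T' h => avgIntegrable_map_homeomorph.2 (hmv.integrable_A T' h)
      integrable_f := fun T' h α => hint (hmv.integrable_F T' h α)
      integrable_P := fun T' h => hint (hmv.integrable_P T' h)
      integrable_H := fun T' h => hint (hmv.integrable_η T' h)
      integrable_gP := fun T' h => hint (hmv.integrable_GP T' h)
      balance := ?balance
      entropy := fun ξ hξ => ?entropy }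
  case balance =>
    simp only [Function.comp_def, havg, havg_id]
    refine ⟨fun T' h => (hmv.integrable_A T' h).2, fun T' h α => (hmv.integrable_F T' h α).2,
      fun T' h => (hmv.integrable_P T' h).2, hmv.integrable_A₀.2.congr hA₀, fun φ hφ => ?_⟩
    have hinitial : ∫ x, φ x 0 • avg ν₀ e x = ∫ x, φ x 0 • v₀ x :=
      integral_congr_ae (hA₀.mono fun x hx => by simp only [hx])
    rw [← hinitial]
    exact hmv.equation φ hφ
  case entropy =>
    have hentropy := hmv.entropy ξ hξ
    rw [measureReal_zero_apply, add_zero,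
      integral_congr_ae (avg_ae_eq_of_ae_eq_dirac hν₀ η)] at hentropy
    simpa only [Function.comp_def, havg, havg (fun w => (inner ℝ (G w) (P w) : ℝ))] using hentropy

lemma exists_lipschitz_extension {X : Type*} [PseudoMetricSpace X] [CompactSpace X] {E : Type*}
    [SeminormedAddCommGroup E] (hT : 0 ≤ T) {v : X → ℝ → E} {K : ℝ≥0}
    (h : LipschitzOnWith K (fun z : X × ℝ => v z.1 z.2) (univ ×ˢ Icc 0 T)) :
    ∃ V : X → ℝ → E, LipschitzWith K (fun z : X × ℝ => V z.1 z.2) ∧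
      (∃ M, ∀ x t, ‖V x t‖ ≤ M) ∧ ∀ x, ∀ t ∈ Icc 0 T, V x t = v x t := by
  have hmem (z : X × ℝ) : (z.1, (projIcc 0 T hT z.2 : ℝ)) ∈ (univ ×ˢ Icc 0 T : Set (X × ℝ)) :=
    ⟨mem_univ _, (projIcc 0 T hT z.2).2⟩
  obtain ⟨M, hM⟩ := (isCompact_univ.prod isCompact_Icc).exists_bound_of_continuousOn h.continuousOn
  refine ⟨fun x t => v x (projIcc 0 T hT t), LipschitzWith.of_dist_le_mul fun z w => ?_,
    ⟨M, fun x t => hM _ (hmem (x, t))⟩, fun x t ht => by simp only [projIcc_of_mem hT ht]⟩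
  refine (h.dist_le_mul _ (hmem z) _ (hmem w)).trans (mul_le_mul_of_nonneg_left ?_ K.2)
  exact max_le_max le_rfl
    (by simpa [Subtype.dist_eq] using (LipschitzWith.projIcc hT).dist_le_mul z.2 w.2)

lemma IsStrongSolution.exists_isLipschitzSolution (hsol : IsStrongSolution T e F P ubar)
    (he : ContDiff ℝ 1 e) (hT : 0 ≤ T) :
    ∃ V, IsLipschitzSolution T (fun α => F α ∘ e.symm) (P ∘ e.symm) V ∧
      ∀ x, ∀ t ∈ Icc 0 T, V x t = e (ubar x t) := by
  obtain ⟨K, hK⟩ := hsol.lipschitz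
  obtain ⟨U, hU, ⟨M, hM⟩, hUeq⟩ := exists_lipschitz_extension hT hK
  obtain ⟨C, -, hC⟩ := exists_norm_le_on_ball he.continuous M
  refine ⟨fun x t => e (U x t), ⟨exists_lipschitzWith_comp he hU fun z => hM z.1 z.2,
    ⟨C, fun x t => hC _ (hM x t)⟩, ?_⟩, fun x t ht => by simp only [hUeq x t ht]⟩
  filter_upwards [hsol.equation, ae_restrict_cyl_mem_Ioo] with z hz hzT
  have hlocal : (fun s => e (U z.1 s)) =ᶠ[𝓝 z.2] fun s => e (ubar z.1 s) := by
    filter_upwards [Icc_mem_nhds hzT.1 hzT.2] with s hs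
    rw [hUeq _ s hs]
  simpa only [hlocal.deriv_eq, Function.comp_apply, e.symm_apply_apply,
    hUeq _ z.2 (Ioo_subset_Icc_self hzT)] using hz

end Transfer

end BalanceLaw

theorem mainTheorem6_general {n d : ℕ} (T p : ℝ) (hT : 0 < T)
    (A : BalanceLaw.State n → BalanceLaw.State n)
    (F : Fin d → BalanceLaw.State n → BalanceLaw.State n)
    (P : BalanceLaw.State n → BalanceLaw.State n)
    (η : BalanceLaw.State n → ℝ) (q : Fin d → BalanceLaw.State n → ℝ)
    (G : BalanceLaw.State n → BalanceLaw.State n)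
    (hstruct : BalanceLaw.EntropyStructure A F η q G)
    (hA : Tendsto A (Bornology.cobounded (BalanceLaw.State n))
      (Bornology.cobounded (BalanceLaw.State n)))
    (hAη : A =o[Bornology.cobounded (BalanceLaw.State n)] η)
    (hFη : ∀ α, F α =o[Bornology.cobounded (BalanceLaw.State n)] η)
    (hGη : BalanceLaw.GrowthG G η)
    (hη : ∀ u, 0 ≤ η u)
    (hP : ContDiff ℝ 1 P)
    (hGP : BalanceLaw.WeaklyDissipative G P ∨ BalanceLaw.GrowthP G P η)
    (u : BalanceLaw.Torus d → ℝ → BalanceLaw.State n)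
    (ν : Kernel (BalanceLaw.Torus d × ℝ) (BalanceLaw.State n))
    (γ : Measure (BalanceLaw.Torus d × ℝ))
    (ν₀ : Kernel (BalanceLaw.Torus d) (BalanceLaw.State n))
    (hmv : BalanceLaw.IsDissipativeMVSolution T p A F P η G u ν γ ν₀ 0)
    (ubar : BalanceLaw.Torus d → ℝ → BalanceLaw.State n)
    (hstrong : BalanceLaw.IsStrongSolution T A F P ubar)
    (hν₀ : ∀ᵐ x : BalanceLaw.Torus d, ν₀ x = Measure.dirac (ubar x 0)) :
    ∀ᵐ z ∂((volume : Measure (BalanceLaw.Torus d × ℝ)).restrict (BalanceLaw.cyl d T)),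
      ν z = Measure.dirac (ubar z.1 z.2) ∧ u z.1 z.2 = ubar z.1 z.2 := by
  obtain ⟨e, rfl, he⟩ := hstruct.exists_homeomorph hA
  have hcons := hstruct.conserved he hη hAη hFη hGη
  have hinfty := BalanceLaw.tendsto_cobounded_of_homeomorph e.symm
  have hP' : ContDiff ℝ 1 (P ∘ e.symm) := hP.comp (he.of_le one_le_two)
  have hdiss := hcons.toCoerciveEntropy.relativelyDissipative hP' (hGP.imp (fun h v w => h _ _)
    fun h => ⟨h.1.comp_tendsto hinfty, h.2.comp_tendsto hinfty⟩)
  obtain ⟨V, hV, hVeq⟩ :=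
    hstrong.exists_isLipschitzSolution (hstruct.contDiff_A.of_le one_le_two) hT.le
  have hmv' := hmv.isConservedMVSolution (v₀ := fun x => V x 0) (by
    simpa only [hVeq _ 0 (left_mem_Icc.2 hT.le), e.symm_apply_apply] using hν₀)
  filter_upwards [hmv'.ae_eq_dirac hcons hP'.continuous hdiss hV hT.le, hmv.mean,
    ae_restrict_mem (BalanceLaw.measurableSet_cyl T)] with z hz hmean hzT
  have hνz : ν z = Measure.dirac (ubar z.1 z.2) := by
    rw [Kernel.map_apply _ e.continuous.measurable, hVeq _ _ ⟨hzT.2.1, hzT.2.2.le⟩,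
      ← Measure.map_dirac' e.continuous.measurable] at hz
    exact e.measurableEmbedding.map_injective hz
  exact ⟨hνz, by rw [hmean.2, BalanceLaw.avg, hνz, integral_dirac]⟩

theorem mainTheorem6 {n d : ℕ} (T p : ℝ) (hT : 0 < T) (hp : 1 < p)
    (A : BalanceLaw.State n → BalanceLaw.State n)
    (F : Fin d → BalanceLaw.State n → BalanceLaw.State n)
    (P : BalanceLaw.State n → BalanceLaw.State n)
    (η : BalanceLaw.State n → ℝ) (q : Fin d → BalanceLaw.State n → ℝ)
    (G : BalanceLaw.State n → BalanceLaw.State n)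
    (hstruct : BalanceLaw.EntropyStructure A F η q G)
    (hgrowth : BalanceLaw.GrowthConditions p A F η)
    (hη : ∀ u, 0 ≤ η u)
    (hP : ContDiff ℝ 1 P)
    (hGP : (BalanceLaw.WeaklyDissipative G P ∧ BalanceLaw.GrowthG G η) ∨
      (BalanceLaw.GrowthG G η ∧ BalanceLaw.GrowthP G P η))
    (u : BalanceLaw.Torus d → ℝ → BalanceLaw.State n)
    (ν : Kernel (BalanceLaw.Torus d × ℝ) (BalanceLaw.State n))
    (γ : Measure (BalanceLaw.Torus d × ℝ))
    (ν₀ : Kernel (BalanceLaw.Torus d) (BalanceLaw.State n))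
    (γ₀ : Measure (BalanceLaw.Torus d))
    (hmv : BalanceLaw.IsDissipativeMVSolution T p A F P η G u ν γ ν₀ γ₀)
    (ubar : BalanceLaw.Torus d → ℝ → BalanceLaw.State n)
    (hstrong : BalanceLaw.IsStrongSolution T A F P ubar)
    (hγ₀ : γ₀ = 0)
    (hν₀ : ∀ᵐ x : BalanceLaw.Torus d, ν₀ x = Measure.dirac (ubar x 0)) :
    ∀ᵐ z ∂((volume : Measure (BalanceLaw.Torus d × ℝ)).restrict (BalanceLaw.cyl d T)),
      ν z = Measure.dirac (ubar z.1 z.2) ∧ u z.1 z.2 = ubar z.1 z.2 := by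
  subst hγ₀
  exact mainTheorem6_general T p hT A F P η q G hstruct (hgrowth.tendsto_A_cobounded (by linarith))
    hgrowth.growth_A hgrowth.growth_F (hGP.elim And.right And.left) hη hP
    (hGP.imp And.left And.right) u ν γ ν₀ hmv ubar hstrong hν₀
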